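/- Let $\mathbf p=(\mathbf p(k))_{k\ge 0}$ be a probability distribution on $\mathbb N$ with $\mathbf p(0)+\mathbf p(1)<1$, let $\ell\ge 1$ be an integer such that $\sum_k k^\ell\mathbf p(k)<\infty$, let $\mu=\sum_k k\,\mathbf p(k)$, and let $\mathbf q:\mathbb N\to[0,1]$ be such that $\mathbf p(k)\mathbf q(k)>0$ for some $k$. Let $\mathbb P$ be the law of the marked Galton--Watson tree: independently of each other, each individual has $k$ children and is marked with probability $\mathbf p(k)\mathbf q(k)$, and has $k$ children and is unmarked with probability $\mathbf p(k)(1-\mathbf q(k))$. Let $Z_n$ be the size of generation $n$ (the root is generation $0$), $M_n$ the number of marked nodes in generations $0,\dots,n-1$ (so $M_0=0$), $M_\infty$ the total number of marked nodes, and $\mathscr F_n$ the $\sigma$-field generated by the tree up to generation $n$ and the marks up to generation $n-1$. For a sequence $a=(a_j)_{j\ge0}$ and $i,z\in\mathbb N$, put \[ S_i(a;z)=\sum_{t_1+\dots+t_z=i}\binom{i}{t_1\cdots t_z}\prod_{j=1}^z a_{t_j}, \] the sum being over $(t_1,\dots,t_z)\in\mathbb N^z$ (so $S_i(a;0)=1$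 if $i=0$ and $0$ otherwise). Then $\mathbb E[M_m^\ell]<\infty$ for all $m\ge0$ and $\mathbb E[M_m^\ell]>0$ for all $m\ge 1$, and there is a non-negative $(\mathscr F_n)$-martingale $(B_n)_{n\ge0}$ with $B_0=1$ such that, for every $n\in\mathbb N$ and every $\Lambda_n\in\mathscr F_n$, \[ \lim_{p\to+\infty}\frac{\mathbb E[\mathbf 1_{\Lambda_n}M_{n+p}^\ell]}{\mathbb E[M_{n+p}^\ell]}=\mathbb E[\mathbf 1_{\Lambda_n}B_n]. \] It is given as follows. (i) If $\mu<1$, then $M_\infty<\infty$ a.s., the moments $\xi_j=\mathbb E[M_\infty^j]=\lim_{p\to\infty}\mathbb E[M_p^j]$ are finite for $0\le j\le\ell$, $\xi_\ell>0$, and $B_n=f_\ell(M_n,Z_n)$ with \[ f_\ell(s,z)=\frac1{\xi_\ell}\sum_{i=0}^\ell\binom{\ell}{i}s^{\ell-i}S_i(\xi;z). \] (ii) If $\mu=1$, then $B_n=Z_n$. (iii) If $\mu>1$, then $B_n=P_\ell(Z_n)/\mu^{\ell n}$, where $P_\ell$ is the polynomial of degree exactly $\ell$, not depending on $n$, such that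 $P_\ell(z)=S_\ell(\omega;z)/\omega_\ell$ for all $z\in\mathbb N$. Here $\omega_0=1$, $\omega_1=\mathbb E[M_1]/(\mu-1)$ and, for $2\le j\le\ell$, \[ \omega_j=\frac1{\mu^j-\mu}\,\mathbb E\Bigl[\sum_{\substack{t_1+\dots+t_{Z_1}=j\\ t_i<j\ \forall i}}\binom{j}{t_1\cdots t_{Z_1}}\prod_{i=1}^{Z_1}\omega_{t_i}\Bigr]; \] moreover $\omega_\ell>0$ and $\omega_j=\lim_{p\to\infty}\mathbb E[M_p^j]/\mu^{jp}$ for $0\le j\le\ell$. -/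

import Mathlib

open MeasureTheory ProbabilityTheory Filter Topology

namespace MarkedGW

/-- A marked plane tree in Neveu's formalism. Nodes are finite words over `ℕ`; the children of a
node `u` with `k` offspring are the words `u ++ [i]` with `i < k` (labels are counted from `0`).
The marks are encoded by the set of nodes whose mark is equal to `1`. -/
@[ext]
structure MarkedTree where
  nodes : Set (List ℕ)
  marked : Set (List ℕ)
  root_mem : [] ∈ nodes
  parent_mem : ∀ (u : List ℕ) (i : ℕ), u ++ [i] ∈ nodes → u ∈ nodes
  offspring : ∀ u ∈ nodes, ∃ k : ℕ, ∀ i : ℕ, u ++ [i] ∈ nodes ↔ i < k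
  marked_subset : marked ⊆ nodes

namespace MarkedTree

/-- The number of children `k_u` of a node `u`. -/
noncomputable def numChildren (t : MarkedTree) (u : List ℕ) : ℕ :=
  {i : ℕ | u ++ [i] ∈ t.nodes}.ncard

/-- The restriction `r_h`: the tree is kept up to generation `h`, the marks up to generation
`h - 1`, and the nodes of generation `h` are unmarked. -/
def restrict (h : ℕ) (t : MarkedTree) : MarkedTree where
  nodes := {u | u ∈ t.nodes ∧ u.length ≤ h}
  marked := {u | u ∈ t.marked ∧ u.length < h}
  root_mem := ⟨t.root_mem, by simp⟩
  parent_mem := fun u i hu => ⟨t.parent_mem u i hu.1, by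
    have := hu.2
    simp only [List.length_append, List.length_cons, List.length_nil] at this
    omega⟩
  offspring := fun u hu => by
    obtain ⟨k, hk⟩ := t.offspring u hu.1
    refine ⟨if u.length < h then k else 0, fun i => ?_⟩
    simp only [Set.mem_ofPred_eq, List.length_append, List.length_cons, List.length_nil, hk]
    split_ifs <;> omega
  marked_subset := fun _ hu => ⟨t.marked_subset hu.1, hu.2.le⟩

/-- `Z_n`, the size of generation `n`. -/
noncomputable def Z (n : ℕ) (t : MarkedTree) : ℕ := {u | u ∈ t.nodes ∧ u.length = n}.ncard

/-- `M_n`, the number of marked nodes in the generations `0, …, n - 1`. -/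
noncomputable def M (n : ℕ) (t : MarkedTree) : ℕ := {u | u ∈ t.marked ∧ u.length < n}.ncard

/-- The total number of marked nodes of the tree (used only when it is finite). -/
noncomputable def totalMarks (t : MarkedTree) : ℕ := t.marked.ncard

/-- The σ-field generated by the restriction `r_n`, which takes countably many values. -/
@[reducible] def sigmaUpTo (n : ℕ) : MeasurableSpace MarkedTree := MeasurableSpace.comap (restrict n) ⊤

/-- The σ-field on the set of marked trees, generated by all the restrictions. -/
instance : MeasurableSpace MarkedTree := ⨆ n, sigmaUpTo n

theorem restrict_restrict {n m : ℕ} (h : n ≤ m) (t : MarkedTree) :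
    restrict n (restrict m t) = restrict n t := by
  ext u
  · simp only [restrict, Set.mem_ofPred_eq]
    constructor
    · rintro ⟨⟨h1, _⟩, h3⟩
      exact ⟨h1, h3⟩
    · rintro ⟨h1, h3⟩
      exact ⟨⟨h1, h3.trans h⟩, h3⟩
  · simp only [restrict, Set.mem_ofPred_eq]
    constructor
    · rintro ⟨⟨h1, _⟩, h3⟩
      exact ⟨h1, h3⟩
    · rintro ⟨h1, h3⟩
      exact ⟨⟨h1, lt_of_lt_of_le h3 h⟩, h3⟩

/-- The filtration `(F_n)`: the tree up to generation `n` and the marks up to generation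
`n - 1`. -/
def filtration : Filtration ℕ (inferInstance : MeasurableSpace MarkedTree) where
  seq := sigmaUpTo
  mono' := fun n m hnm => by
    rintro s ⟨A, -, rfl⟩
    refine ⟨restrict n ⁻¹' A, trivial, ?_⟩
    ext t
    simp only [Set.mem_preimage, restrict_restrict hnm]
  le' := fun n => le_iSup sigmaUpTo n

theorem finite_generation (t : MarkedTree) (n : ℕ) :
    {u | u ∈ t.nodes ∧ u.length = n}.Finite := by
  induction n with
  | zero =>
    refine (Set.finite_singleton ([] : List ℕ)).subset ?_
    rintro u ⟨_, hu⟩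
    exact List.length_eq_zero_iff.mp hu
  | succ n ih =>
    have hfin : ∀ u ∈ {u | u ∈ t.nodes ∧ u.length = n},
        ((fun i : ℕ => u ++ [i]) '' {i | u ++ [i] ∈ t.nodes}).Finite := by
      rintro u ⟨hu, _⟩
      obtain ⟨k, hk⟩ := t.offspring u hu
      refine Set.Finite.image _ ((Set.finite_lt_nat k).subset fun i hi => (hk i).1 hi)
    refine (ih.biUnion hfin).subset ?_
    rintro u ⟨hu, hl⟩
    obtain rfl | ⟨v, i, rfl⟩ := List.eq_nil_or_concat' u
    · simp at hl
    · refine Set.mem_biUnion (x := v) ⟨t.parent_mem v i hu, ?_⟩ ⟨i, hu, rfl⟩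
      simpa using hl

theorem finite_upTo (t : MarkedTree) (n : ℕ) :
    {u | u ∈ t.nodes ∧ u.length ≤ n}.Finite := by
  refine ((Set.finite_le_nat n).biUnion fun m _ => finite_generation t m).subset ?_
  rintro u ⟨hu, hl⟩
  exact Set.mem_biUnion (x := u.length) hl ⟨hu, rfl⟩

end MarkedTree

open MarkedTree

/-- The marked tree in which every node `u` has `(ω u).1` children, and is marked if and only if
`(ω u).2` is `true`. -/
def treeOf (ω : List ℕ → ℕ × Bool) : MarkedTree where
  nodes := {u | ∀ v i, v ++ [i] <+: u → i < (ω v).1}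
  marked := {u | (∀ v i, v ++ [i] <+: u → i < (ω v).1) ∧ (ω u).2 = true}
  root_mem := by simp
  parent_mem := fun u i hu v j hv => hu v j (hv.trans (List.prefix_append u [i]))
  offspring := fun u hu => by
    refine ⟨(ω u).1, fun i => ⟨fun h => h u i (List.prefix_refl _), fun hi v j hv => ?_⟩⟩
    rcases List.prefix_concat_iff.mp hv with h | h
    · obtain ⟨rfl, h2⟩ := List.append_inj' h rfl
      simp only [List.cons.injEq, and_true] at h2
      exact h2 ▸ hi
    · exact hu v j h
  marked_subset := fun _ hu => hu.1

theorem measurable_treeOf : Measurable treeOf := by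
  have hcoord : ∀ u : List ℕ, Measurable fun ω : List ℕ → ℕ × Bool => ω u :=
    fun u => measurable_pi_apply u
  have hnode : ∀ u, MeasurableSet {ω | u ∈ (treeOf ω).nodes} := by
    intro u
    have : {ω | u ∈ (treeOf ω).nodes} =
        ⋂ v : List ℕ, ⋂ i : ℕ, {ω | v ++ [i] <+: u → i < (ω v).1} := by
      ext ω
      simp [treeOf]
    rw [this]
    refine MeasurableSet.iInter fun v => MeasurableSet.iInter fun i => ?_
    exact (hcoord v) (MeasurableSet.of_discrete (s := {x : ℕ × Bool | v ++ [i] <+: u → i < x.1}))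
  have hmark : ∀ u, MeasurableSet {ω | u ∈ (treeOf ω).marked} := by
    intro u
    exact (hnode u).inter
      ((hcoord u) (MeasurableSet.of_discrete (s := {x : ℕ × Bool | x.2 = true})))
  rw [measurable_iff_comap_le]
  change MeasurableSpace.comap treeOf (⨆ n, sigmaUpTo n) ≤ _
  rw [MeasurableSpace.comap_iSup]
  refine iSup_le fun n => ?_
  simp only [sigmaUpTo, MeasurableSpace.comap_comp]
  rintro _ ⟨S, -, rfl⟩
  have hfn : ∀ t, (restrict n t).nodes.Finite := fun t => finite_upTo t n
  have hfm : ∀ t, (restrict n t).marked.Finite :=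
    fun t => (hfn t).subset (restrict n t).marked_subset
  let g : (List ℕ → ℕ × Bool) → Finset (List ℕ) × Finset (List ℕ) :=
    fun ω => ((hfn (treeOf ω)).toFinset, (hfm (treeOf ω)).toFinset)
  have hg : Measurable g := by
    refine measurable_to_countable' fun ab => ?_
    have : g ⁻¹' {ab} = ⋂ u : List ℕ,
        ({ω | (u ∈ (treeOf ω).nodes ∧ u.length ≤ n) ↔ u ∈ ab.1} ∩
        {ω | (u ∈ (treeOf ω).marked ∧ u.length < n) ↔ u ∈ ab.2}) := by
      ext ω
      simp only [g, Set.mem_preimage, Set.mem_singleton_iff, Prod.ext_iff, Finset.ext_iff,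
        Set.Finite.mem_toFinset, restrict, Set.mem_ofPred_eq, Set.mem_iInter, Set.mem_inter_iff,
        forall_and]
    rw [this]
    refine MeasurableSet.iInter fun u => MeasurableSet.inter ?_ ?_
    · exact ((hnode u).inter (MeasurableSet.const _)).iff (MeasurableSet.const _)
    · exact ((hmark u).inter (MeasurableSet.const _)).iff (MeasurableSet.const _)
  have hS : (restrict n ∘ treeOf) ⁻¹' S =
      g ⁻¹' {ab | ∃ ω, g ω = ab ∧ restrict n (treeOf ω) ∈ S} := by
    ext ω
    constructor
    · exact fun h => ⟨ω, rfl, h⟩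
    · rintro ⟨ω', h, hm⟩
      have h1 := Set.Finite.toFinset_inj.mp (congrArg Prod.fst h)
      have h2 := Set.Finite.toFinset_inj.mp (congrArg Prod.snd h)
      have : restrict n (treeOf ω') = restrict n (treeOf ω) := MarkedTree.ext h1 h2
      change restrict n (treeOf ω) ∈ S
      rw [← this]
      exact hm
  rw [hS]
  exact hg (MeasurableSet.of_discrete)

/-- The marking-reproduction law `p₀` on `ℕ × {0, 1}`:
`p₀(k, 1) = p(k) q(k)` and `p₀(k, 0) = p(k) (1 - q(k))`. -/
noncomputable def reproMark (p : PMF ℕ) (q : ℕ → unitInterval) : PMF (ℕ × Bool) :=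
  ⟨fun x => p x.1 * ENNReal.ofReal (if x.2 = true then (q x.1 : ℝ) else 1 - (q x.1 : ℝ)), by
    have h : ∑' x : ℕ × Bool,
        p x.1 * ENNReal.ofReal (if x.2 = true then (q x.1 : ℝ) else 1 - (q x.1 : ℝ)) = 1 := by
      rw [ENNReal.tsum_prod', ← p.tsum_coe]
      refine tsum_congr fun k => ?_
      rw [tsum_bool, ← mul_add]
      simp only [Bool.false_eq_true, if_false, if_true]
      rw [← ENNReal.ofReal_add (by linarith [(q k).2.2]) (q k).2.1]
      simp
    exact h ▸ ENNReal.summable.hasSum⟩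

/-- The law of the marked Galton-Watson tree with offspring distribution `p` and mark function
`q`: the law of the tree whose pairs (number of children, mark) are independent with
marking-reproduction law `p₀`. -/
noncomputable def law (p : PMF ℕ) (q : ℕ → unitInterval) : Measure MarkedTree :=
  (Measure.infinitePi fun _ : List ℕ => (reproMark p q).toMeasure).map treeOf

instance (p : PMF ℕ) (q : ℕ → unitInterval) : IsProbabilityMeasure (law p q) :=
  Measure.isProbabilityMeasure_map measurable_treeOf.aemeasurable

theorem treeOf_append (ω : List ℕ → ℕ × Bool) (u : List ℕ) (i : ℕ) :
    u ++ [i] ∈ (treeOf ω).nodes ↔ u ∈ (treeOf ω).nodes ∧ i < (ω u).1 := by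
  constructor
  · exact fun h => ⟨(treeOf ω).parent_mem u i h, h u i (List.prefix_refl _)⟩
  · rintro ⟨hu, hi⟩ v j hv
    rcases List.prefix_concat_iff.mp hv with h | h
    · obtain ⟨rfl, h2⟩ := List.append_inj' h rfl
      simp only [List.cons.injEq, and_true] at h2
      exact h2 ▸ hi
    · exact hu v j h

theorem mem_append_iff (t : MarkedTree) (u : List ℕ) (i : ℕ) :
    u ++ [i] ∈ t.nodes ↔ u ∈ t.nodes ∧ i < t.numChildren u := by
  constructor
  · intro h
    have hu := t.parent_mem u i h
    obtain ⟨k, hk⟩ := t.offspring u hu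
    have : t.numChildren u = k := by
      simp only [numChildren, hk]
      have hfs : {i : ℕ | i < k} = ((Finset.range k : Finset ℕ) : Set ℕ) := by ext; simp
      rw [hfs, Set.ncard_coe_finset, Finset.card_range]
    exact ⟨hu, this ▸ (hk i).1 h⟩
  · rintro ⟨hu, hi⟩
    obtain ⟨k, hk⟩ := t.offspring u hu
    have : t.numChildren u = k := by
      simp only [numChildren, hk]
      have hfs : {i : ℕ | i < k} = ((Finset.range k : Finset ℕ) : Set ℕ) := by ext; simp
      rw [hfs, Set.ncard_coe_finset, Finset.card_range]
    exact (hk i).2 (this ▸ hi)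

open Classical in
/-- The characterization of the law of the marked Galton-Watson tree by its finite-dimensional
marginals: the restriction to the first `h` generations has the product probability. -/
theorem law_restrict (p : PMF ℕ) (q : ℕ → unitInterval) (h : ℕ) (t : MarkedTree) :
    law p q {t' | restrict h t' = restrict h t} =
      ∏ u ∈ (finite_upTo t h).toFinset with u.length < h,
        reproMark p q (t.numChildren u, decide (u ∈ t.marked)) := by
  have hms : MeasurableSet {t' | restrict h t' = restrict h t} :=
    (filtration.le h) _ ⟨{restrict h t}, trivial, rfl⟩
  rw [law, Measure.map_apply measurable_treeOf hms]
  have hset : treeOf ⁻¹' {t' | restrict h t' = restrict h t} =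
      Set.pi ((finite_upTo t h).toFinset.filter fun u => u.length < h)
        (fun u => {(t.numChildren u, decide (u ∈ t.marked))}) := by
    ext ω
    simp only [Set.mem_preimage, Set.mem_ofPred_eq, Set.mem_pi, Finset.coe_filter,
      Set.Finite.mem_toFinset, Set.mem_singleton_iff]
    constructor
    · rintro he u ⟨⟨hu, -⟩, hl⟩
      have hn : ∀ v : List ℕ, v.length ≤ h → (v ∈ (treeOf ω).nodes ↔ v ∈ t.nodes) := by
        intro v hv
        have := Set.ext_iff.mp (congrArg MarkedTree.nodes he) v
        simpa [restrict, hv] using this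
      have hm := Set.ext_iff.mp (congrArg MarkedTree.marked he) u
      simp only [restrict, Set.mem_ofPred_eq, hl, and_true] at hm
      have huω := (hn u hl.le).2 hu
      have hk : ∀ i, i < (ω u).1 ↔ i < t.numChildren u := by
        intro i
        have := hn (u ++ [i]) (by simpa using hl)
        rw [treeOf_append, mem_append_iff] at this
        simpa [huω, hu] using this
      have hmk : (ω u).2 = true ↔ u ∈ t.marked := by
        rw [← hm]
        exact ⟨fun h => ⟨huω, h⟩, fun h => h.2⟩
      refine Prod.ext ?_ ?_
      · have h1 := hk (ω u).1
        have h2 := hk (t.numChildren u)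
        simp only [lt_irrefl, false_iff, iff_false, not_lt] at h1 h2
        exact le_antisymm h2 h1
      · rw [Bool.eq_iff_iff, hmk, decide_eq_true_eq]
    · intro H
      have hn : ∀ m : ℕ, ∀ v : List ℕ, v.length = m → v.length ≤ h →
          (v ∈ (treeOf ω).nodes ↔ v ∈ t.nodes) := by
        intro m
        induction m with
        | zero =>
          intro v hv _
          rw [List.length_eq_zero_iff] at hv
          subst hv
          simp [root_mem]
        | succ m ih =>
          intro v hv hvh
          obtain rfl | ⟨u, i, rfl⟩ := List.eq_nil_or_concat' v
          · simp at hv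
          · simp only [List.length_append, List.length_cons, List.length_nil] at hv hvh
            rw [treeOf_append, mem_append_iff, ih u (by omega) (by omega)]
            refine and_congr_right fun hu => ?_
            rw [H u ⟨⟨hu, by omega⟩, by omega⟩]
      refine MarkedTree.ext ?_ ?_
      · ext v
        simp only [restrict, Set.mem_ofPred_eq]
        exact and_congr_left fun hv => hn _ v rfl hv
      · ext v
        simp only [restrict, Set.mem_ofPred_eq]
        refine and_congr_left fun hv => ?_
        have hvn := hn _ v rfl hv.le
        constructor
        · rintro ⟨h1, h2⟩
          rw [H v ⟨⟨hvn.1 h1, hv.le⟩, hv⟩] at h2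
          simpa using h2
        · intro h1
          have hvt := t.marked_subset h1
          refine ⟨hvn.2 hvt, ?_⟩
          rw [H v ⟨⟨hvt, hv.le⟩, hv⟩]
          simpa using h1
  rw [hset, Measure.infinitePi_pi _ (fun _ _ => MeasurableSet.of_discrete)]
  refine Finset.prod_congr rfl fun u _ => ?_
  exact PMF.toMeasure_apply_singleton _ _ (MeasurableSet.of_discrete)

/-- The mean `μ` of the offspring distribution (used only when the mean is finite). -/
noncomputable def mean (p : PMF ℕ) : ℝ := ∑' k : ℕ, (k : ℝ) * (p k).toReal

/-- The sum over all `(t_1, …, t_z) ∈ ℕ^z` with `t_1 + ⋯ + t_z = i` of the multinomial coefficient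
times `a_{t_1} ⋯ a_{t_z}`. For `z = 0` it is `1` if `i = 0` and `0` otherwise. -/
noncomputable def multiSum (a : ℕ → ℝ) (i z : ℕ) : ℝ :=
  ∑ t ∈ Finset.piAntidiag (Finset.univ : Finset (Fin z)) i,
    (Nat.multinomial Finset.univ t : ℝ) * ∏ j, a (t j)

/-- The moments `ξ_j` of the total number of marks. -/
noncomputable def xi (p : PMF ℕ) (q : ℕ → unitInterval) (j : ℕ) : ℝ :=
  ∫ t, (totalMarks t : ℝ) ^ j ∂(law p q)

/-- The function `f_ℓ(s, z)` of the sub-critical case. -/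
noncomputable def f (p : PMF ℕ) (q : ℕ → unitInterval) (ℓ s z : ℕ) : ℝ :=
  (1 / xi p q ℓ) * ∑ i ∈ Finset.range (ℓ + 1),
    (ℓ.choose i : ℝ) * (s : ℝ) ^ (ℓ - i) * multiSum (xi p q) i z

/-- The constants `ω_j` of the super-critical case: `ω_0 = 1`, `ω_1 = E[M_1] / (μ - 1)` and,
for `j ≥ 2`, `ω_j = (μ^j - μ)⁻¹ E[∑ multinomial(j; t_1, …, t_{Z_1}) ω_{t_1} ⋯ ω_{t_{Z_1}}]`, where
the sum is over `t_1 + ⋯ + t_{Z_1} = j` with all `t_i < j`. -/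
noncomputable def omega (p : PMF ℕ) (q : ℕ → unitInterval) : ℕ → ℝ
  | 0 => 1
  | 1 => (∑' k : ℕ, (p k).toReal * (q k : ℝ)) / (mean p - 1)
  | (m + 2) => (∑' k : ℕ, (p k).toReal *
      ∑ t ∈ Finset.piAntidiag (Finset.univ : Finset (Fin k)) (m + 2),
        (Nat.multinomial Finset.univ t : ℝ) *
          ∏ i, (if _h : t i < m + 2 then omega p q (t i) else 0)) /
      (mean p ^ (m + 2) - mean p)
termination_by j => j

/-- The process `B` is the martingale obtained by penalization by `M_{n+r}^ℓ` under `P`: it is a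
non-negative martingale with `B_0 = 1`, and for every `n` and every `Λ ∈ F_n`, the ratio
`E[1_Λ M_{n+r}^ℓ] / E[M_{n+r}^ℓ]` converges to `E[1_Λ B_n]` as `r → ∞`. -/
structure IsPenalizationMartingale (P : Measure MarkedTree) (ℓ : ℕ)
    (B : ℕ → MarkedTree → ℝ) : Prop where
  martingale : Martingale B filtration P
  nonneg : ∀ n t, 0 ≤ B n t
  init : ∀ t, B 0 t = 1
  limit : ∀ (n : ℕ) (Λ : Set MarkedTree), MeasurableSet[filtration n] Λ →
    Tendsto (fun r : ℕ =>
      (∫ t in Λ, (M (n + r) t : ℝ) ^ ℓ ∂P) / (∫ t, (M (n + r) t : ℝ) ^ ℓ ∂P))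
      atTop (𝓝 (∫ t in Λ, B n t ∂P))

end MarkedGW

open MarkedGW MarkedTree

/-! Cutting the tree at generation n gives `M_add`: the marks in the first n + m generations are
those before n plus the marks in the first m generations of the subtrees of the Z_n nodes of
generation n. Given F_n these subtrees are independent copies of the whole tree. The i-th moment of
a sum of z independent copies of M_m is the z-th binomial convolution power of the moment sequence
x_m; since the moment of order 0 is 1, it equals the sum over r ≤ i of `z.choose r` times a
coefficient `redPow (x_m) r i` free of z (`convPow_eq_sum_redPow`).

Consequently E[1_Λ M_{n+m}^ℓ] is a finite sum of deterministic coefficients times E[1_Λ M_n^(ℓ-i)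
(Z_n choose r)] (`setIntegral_M_add_pow`). After division by E[M_{n+m}^ℓ], only the limits of the
numbers `redPow (x_m) r i / x_{n+m} ℓ` in m are needed, and no exchange of limit and expectation
occurs. The limit is the integral of an explicit density in (M_n, Z_n); its martingale property
follows from uniqueness of limits (`isPenalizationMartingale_density`).

Cutting at generation 1 gives x_{n+1}(j) = μ x_n(j) + a remainder in lower moments, an affine
recursion solved by induction on j (`MomentRecursion`). If μ < 1, the moments converge and every
coefficient has a limit. If μ > 1, x_n(j) / μ^(jn) tends to ω_j, so only the terms i = ℓ survive. If
μ = 1, x_n(j) is of exact order n^(2j-1), so only i = ℓ, r = 1 survives, and the density is Z_n. -/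

namespace MarkedGW

/-! ### Binomial convolution powers and their dependence on the number of factors. -/

section ConvPow

open Finset

variable {R : Type*} [CommSemiring R]

/-- The `z`-th power of the sequence `a` for the binomial convolution. -/
def convPow (a : ℕ → R) : ℕ → ℕ → R
  | 0, i => if i = 0 then 1 else 0
  | z + 1, i => ∑ x ∈ antidiagonal i, (i.choose x.1 : R) * a x.1 * convPow a z x.2

/-- The convolution powers of the sequence obtained from `a` by replacing `a 0` by `0`. -/
def redPow (a : ℕ → R) : ℕ → ℕ → R := convPow fun t => if t = 0 then 0 else a t

theorem convPow_zero (a : ℕ → R) (i : ℕ) : convPow a 0 i = if i = 0 then 1 else 0 := rfl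

theorem convPow_succ (a : ℕ → R) (z i : ℕ) : convPow a (z + 1) i =
    ∑ x ∈ antidiagonal i, (i.choose x.1 : R) * a x.1 * convPow a z x.2 := rfl

theorem redPow_zero (a : ℕ → R) (i : ℕ) : redPow a 0 i = if i = 0 then 1 else 0 := rfl

theorem redPow_succ (a : ℕ → R) (z i : ℕ) : redPow a (z + 1) i =
    ∑ x ∈ antidiagonal i, (i.choose x.1 : R) * (if x.1 = 0 then 0 else a x.1) * redPow a z x.2 :=
  rfl

theorem convPow_congr {a b : ℕ → R} {i : ℕ} (h : ∀ t ≤ i, a t = b t) (z : ℕ) :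
    convPow a z i = convPow b z i := by
  induction z generalizing i with
  | zero => rfl
  | succ z ih =>
    rw [convPow_succ, convPow_succ]
    refine sum_congr rfl fun x hx => ?_
    have hx := mem_antidiagonal.1 hx
    rw [h x.1 (by omega), ih fun t ht => h t (by omega)]

theorem redPow_congr {a b : ℕ → R} {i : ℕ} (h : ∀ t ≤ i, a t = b t) (r : ℕ) :
    redPow a r i = redPow b r i :=
  convPow_congr (fun t ht => by rw [h t ht]) r

/-- The value at 0 has been removed, so each of the r factors uses up at least one unit of i. -/
theorem redPow_eq_zero (a : ℕ → R) {r i : ℕ} (h : i < r) : redPow a r i = 0 := by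
  induction r generalizing i with
  | zero => omega
  | succ r ih =>
    rw [redPow_succ]
    refine sum_eq_zero fun x hx => ?_
    have hx := mem_antidiagonal.1 hx
    by_cases h0 : x.1 = 0
    · simp [h0]
    · rw [ih (by omega), mul_zero]

theorem redPow_zero_of_pos (a : ℕ → R) {i : ℕ} (h : 1 ≤ i) : redPow a 0 i = 0 := by
  rw [redPow_zero, if_neg (by omega)]

theorem redPow_one (a : ℕ → R) {i : ℕ} (h : 1 ≤ i) : redPow a 1 i = a i := by
  rw [redPow_succ, sum_eq_single (i, 0)]
  · rw [if_neg (show i ≠ 0 by omega)]; simp [redPow_zero]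
  · rintro ⟨x, y⟩ hx hne
    have hx := mem_antidiagonal.1 hx
    have : y ≠ 0 := by rintro rfl; simp_all
    simp [redPow_zero, this]
  · simp

/-- For `r ≥ 2` only the values `a t` with `t < i` matter. -/
theorem redPow_congr_of_two_le {a b : ℕ → R} {i : ℕ} (h : ∀ t < i, a t = b t) {r : ℕ}
    (hr : 2 ≤ r) : redPow a r i = redPow b r i := by
  obtain ⟨r, rfl⟩ := Nat.exists_eq_add_of_le hr
  rw [show 2 + r = r + 1 + 1 by omega, redPow_succ, redPow_succ]
  refine sum_congr rfl fun x hx => ?_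
  have hx := mem_antidiagonal.1 hx
  rcases Nat.eq_zero_or_pos x.2 with h2 | h2
  · rw [h2, redPow_eq_zero _ (by omega), redPow_eq_zero _ (by omega)]; simp
  · by_cases h0 : x.1 = 0
    · simp [h0]
    · rw [h x.1 (by omega), redPow_congr (a := a) (b := b) fun t ht => h t (by omega)]

theorem sum_range_redPow (a : ℕ → R) (g : ℕ → R) {i N : ℕ} (h : i ≤ N) :
    ∑ r ∈ range (N + 1), g r * redPow a r i = ∑ r ∈ range (i + 1), g r * redPow a r i := by
  symm
  refine sum_subset (range_subset_range.2 (by omega)) fun r _ hr => ?_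
  rw [redPow_eq_zero _ (by simpa using hr), mul_zero]

/-- In terms of exponential generating functions this is A^z = (1 + (A - 1))^z expanded by the
binomial theorem; the terms r > i vanish because A - 1 has no constant term. The induction on z is
Pascal's rule. -/
theorem convPow_eq_sum_redPow {a : ℕ → R} (ha : a 0 = 1) (z i : ℕ) :
    convPow a z i = ∑ r ∈ range (i + 1), (z.choose r : R) * redPow a r i := by
  induction z generalizing i with
  | zero =>
    rw [sum_range_succ']
    simp [convPow_zero, redPow_zero]
  | succ z ih =>
    have h1 : convPow a (z + 1) i = convPow a z i +
        ∑ x ∈ antidiagonal i, (i.choose x.1 : R) * (if x.1 = 0 then 0 else a x.1) *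
          convPow a z x.2 := by
      rw [convPow_succ]
      have : convPow a z i = ∑ x ∈ antidiagonal i, if x = (0, i) then convPow a z x.2 else 0 := by
        rw [sum_ite_eq' _ (0, i), if_pos (by simp)]
      rw [this, ← sum_add_distrib]
      refine sum_congr rfl fun x hx => ?_
      have hx := mem_antidiagonal.1 hx
      by_cases h0 : x.1 = 0
      · have : x = (0, i) := Prod.ext h0 (by simpa [h0] using hx)
        simp [this, ha]
      · have : x ≠ (0, i) := fun h => h0 (by simp [h])
        simp [this, h0]
    have h2 : ∑ x ∈ antidiagonal i, (i.choose x.1 : R) * (if x.1 = 0 then 0 else a x.1) *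
          convPow a z x.2 = ∑ r ∈ range (i + 1), (z.choose r : R) * redPow a (r + 1) i := by
      simp only [redPow_succ, mul_sum]
      rw [sum_comm]
      refine sum_congr rfl fun x hx => ?_
      have hx := mem_antidiagonal.1 hx
      rw [ih, ← sum_range_redPow a _ (show x.2 ≤ i by omega), mul_sum]
      exact sum_congr rfl fun r _ => by ring
    have h3 : ∑ r ∈ range (i + 1), (z.choose r : R) * redPow a (r + 1) i =
        ∑ r ∈ range i, (z.choose r : R) * redPow a (r + 1) i := by
      rw [sum_range_succ, redPow_eq_zero _ (Nat.lt_succ_self i)]; simp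
    rw [h1, h2, h3, ih, sum_range_succ', sum_range_succ', add_right_comm, ← sum_add_distrib]
    simp only [Nat.choose_zero_right]
    congr 1
    refine sum_congr rfl fun r _ => ?_
    rw [Nat.choose_succ_succ]
    push_cast
    ring

/-- Each term is a product of r values whose indices sum to i. The case y = 1 gives the geometric
normalization for μ > 1; x = n², y = 1/n gives the critical growth rate. -/
theorem redPow_homogeneous (a : ℕ → R) (x y : R) (r i : ℕ) :
    redPow (fun t => x ^ t * y * a t) r i = x ^ i * y ^ r * redPow a r i := by
  induction r generalizing i with
  | zero =>
    by_cases h : i = 0 <;> simp [redPow_zero, h]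
  | succ r ih =>
    rw [redPow_succ, redPow_succ, mul_sum]
    refine sum_congr rfl fun u hu => ?_
    have hu := mem_antidiagonal.1 hu
    rw [ih, ← hu]
    by_cases h0 : u.1 = 0
    · simp [h0]
    · simp only [h0, if_false]; ring

end ConvPow

/-! ### Order and limits for real convolution powers. -/

section Real

open Finset

theorem redPow_nonneg {a : ℕ → ℝ} (ha : ∀ t, 0 ≤ a t) (r i : ℕ) : 0 ≤ redPow a r i := by
  induction r generalizing i with
  | zero => rw [redPow_zero]; split_ifs <;> norm_num
  | succ r ih =>
    rw [redPow_succ]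
    refine sum_nonneg fun x _ => mul_nonneg (mul_nonneg (by positivity) ?_) (ih _)
    split_ifs
    exacts [le_rfl, ha _]

theorem redPow_le_redPow {a b : ℕ → ℝ} {i : ℕ} (ha : ∀ t, 0 ≤ a t)
    (h : ∀ t, 1 ≤ t → t ≤ i → a t ≤ b t) (r : ℕ) : redPow a r i ≤ redPow b r i := by
  induction r generalizing i with
  | zero => rfl
  | succ r ih =>
    rw [redPow_succ, redPow_succ]
    refine sum_le_sum fun x hx => ?_
    have hx := mem_antidiagonal.1 hx
    by_cases h0 : x.1 = 0
    · simp [h0]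
    · simp only [h0, if_false]
      have h1 := h x.1 (by omega) (by omega)
      refine mul_le_mul (mul_le_mul_of_nonneg_left h1 (by positivity))
        (ih fun t h1 h2 => h t h1 (by omega)) (redPow_nonneg ha _ _)
        (mul_nonneg (by positivity) ((ha _).trans h1))

/-- With at least two factors, each of index at least 1, the index i itself never occurs, so both
sequences may be set to 0 from i on. -/
theorem redPow_le_redPow_of_two_le {a b : ℕ → ℝ} {i : ℕ} (ha : ∀ t, 0 ≤ a t)
    (h : ∀ t, 1 ≤ t → t < i → a t ≤ b t) {r : ℕ} (hr : 2 ≤ r) : redPow a r i ≤ redPow b r i := by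
  rw [redPow_congr_of_two_le (b := fun t => if t < i then a t else 0)
      (fun t ht => by rw [if_pos ht]) hr,
    redPow_congr_of_two_le (a := b) (b := fun t => if t < i then b t else 0)
      (fun t ht => by rw [if_pos ht]) hr]
  refine redPow_le_redPow (fun t => ?_) (fun t h1 _ => ?_) r
  · split_ifs
    exacts [ha t, le_rfl]
  · split_ifs with h2
    exacts [h t h1 h2, le_rfl]

theorem redPow_pos {a : ℕ → ℝ} (ha : ∀ t, 0 ≤ a t) {r i : ℕ}
    (h : ∀ t, 1 ≤ t → t ≤ i → 0 < a t) (hr : 1 ≤ r) (hri : r ≤ i) : 0 < redPow a r i := by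
  induction r, hr using Nat.le_induction generalizing i with
  | base => rw [redPow_one _ hri]; exact h i hri le_rfl
  | succ r hr ih =>
    have h1 := h 1 le_rfl (by omega)
    have h2 := ih (i := i - 1) (fun t h1 h2 => h t h1 (by omega)) (by omega)
    rw [redPow_succ]
    refine sum_pos' (fun x _ => mul_nonneg (mul_nonneg (by positivity) ?_) (redPow_nonneg ha _ _))
      ⟨(1, i - 1), mem_antidiagonal.2 (by simp; omega), ?_⟩
    · split_ifs
      exacts [le_rfl, ha _]
    · have : (0 : ℝ) < i.choose 1 := by exact_mod_cast Nat.choose_pos (by omega)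
      simp only [one_ne_zero, if_false]
      positivity

/-- Only the term (1, i - 1) is kept, and its binomial coefficient i is bounded below by 1. This
product drives the lower bound on critical moments. -/
theorem mul_le_redPow_two {a : ℕ → ℝ} (ha : ∀ t, 0 ≤ a t) {i : ℕ} (hi : 2 ≤ i) :
    a 1 * a (i - 1) ≤ redPow a 2 i := by
  rw [redPow_succ]
  refine le_trans ?_ (single_le_sum (f := fun x : ℕ × ℕ => (i.choose x.1 : ℝ) *
    (if x.1 = 0 then 0 else a x.1) * redPow a 1 x.2) (fun x _ => mul_nonneg (mul_nonneg
      (by positivity) ?_) (redPow_nonneg ha _ _)) (a := (1, i - 1))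
      (mem_antidiagonal.2 (by simp; omega)))
  · have h1 : (1 : ℝ) ≤ i.choose 1 := by simp; omega
    simp only [one_ne_zero, if_false]
    rw [redPow_one _ (by omega), mul_assoc]
    exact le_mul_of_one_le_left (mul_nonneg (ha _) (ha _)) h1
  · split_ifs
    exacts [le_rfl, ha _]

theorem tendsto_redPow {ι : Type*} {F : Filter ι} {a : ι → ℕ → ℝ} {b : ℕ → ℝ} {i : ℕ}
    (h : ∀ t ≤ i, Tendsto (fun x => a x t) F (𝓝 (b t))) (r : ℕ) :
    Tendsto (fun x => redPow (a x) r i) F (𝓝 (redPow b r i)) := by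
  induction r generalizing i with
  | zero => exact tendsto_const_nhds
  | succ r ih =>
    simp only [redPow_succ]
    refine tendsto_finsetSum _ fun x hx => ?_
    have hx := mem_antidiagonal.1 hx
    by_cases h0 : x.1 = 0
    · simpa [h0] using tendsto_const_nhds
    · simp only [h0, if_false]
      exact ((h _ (by omega)).const_mul _).mul (ih fun t ht => h t (by omega))

theorem tendsto_redPow_of_two_le {ι : Type*} {F : Filter ι} {a : ι → ℕ → ℝ} {b : ℕ → ℝ} {i : ℕ}
    (h : ∀ t < i, Tendsto (fun x => a x t) F (𝓝 (b t))) {r : ℕ} (hr : 2 ≤ r) :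
    Tendsto (fun x => redPow (a x) r i) F (𝓝 (redPow b r i)) := by
  have h' := tendsto_redPow (F := F) (a := fun x t => if t < i then a x t else 0)
    (b := fun t => if t < i then b t else 0) (i := i) (fun t _ => by
      by_cases ht : t < i
      · simpa [ht] using h t ht
      · simpa [ht] using tendsto_const_nhds) r
  rw [redPow_congr_of_two_le (b := b) (fun t ht => by rw [if_pos ht]) hr] at h'
  refine h'.congr fun x => redPow_congr_of_two_le (fun t ht => by rw [if_pos ht]) hr

/-- Coordinates are peeled off one at a time: `Nat.multinomial_cons` splits the multinomial
coefficient into a binomial one and a smaller multinomial one. -/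
theorem multiSum_eq_convPow (a : ℕ → ℝ) (i z : ℕ) : multiSum a i z = convPow a z i := by
  have key : ∀ (s : Finset (Fin z)) (i : ℕ), ∑ t ∈ piAntidiag s i,
      (Nat.multinomial s t : ℝ) * ∏ j ∈ s, a (t j) = convPow a s.card i := by
    intro s
    induction s using Finset.cons_induction with
    | empty =>
      intro i
      by_cases h : i = 0
      · simp [h, convPow_zero]
      · simp [h, convPow_zero]
    | cons u s hu ih =>
      intro i
      rw [piAntidiag_cons, sum_disjiUnion, card_cons, convPow_succ]
      refine sum_congr rfl fun x hx => ?_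
      have hx := mem_antidiagonal.1 hx
      rw [sum_map, ← ih, mul_sum]
      refine sum_congr rfl fun t ht => ?_
      rw [mem_piAntidiag] at ht
      have h0 : t u = 0 := by
        by_contra hne
        exact hu (ht.2 u hne)
      have hs : ∀ j ∈ s, ((addRightEmbedding fun j => if j = u then x.1 else 0) t) j = t j := by
        intro j hj
        have : j ≠ u := fun h => hu (h ▸ hj)
        simp [this]
      have hu' : ((addRightEmbedding fun j => if j = u then x.1 else 0) t) u = x.1 := by simp [h0]
      rw [prod_cons, hu', prod_congr rfl fun j hj => by rw [hs j hj], Nat.multinomial_cons hu, hu',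
        sum_congr rfl hs, ht.1, hx, Nat.multinomial_congr hs]
      push_cast
      ring
  simpa [multiSum] using key univ i

end Real

end MarkedGW

namespace MarkedGW

/-! ### Asymptotics of the moment recursion. -/

section Recursion

open Finset

/-- The deviation from the fixed point b / (1 - α) is contracted by α at each step, up to the error
y n - b. -/
theorem tendsto_of_affine_recursion {x y : ℕ → ℝ} {α b : ℝ} (h0 : 0 ≤ α) (h1 : α < 1)
    (hx : ∀ n, x (n + 1) = α * x n + y n) (hy : Tendsto y atTop (𝓝 b)) :
    Tendsto x atTop (𝓝 (b / (1 - α))) := by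
  have hα : 0 < 1 - α := by linarith
  rw [Metric.tendsto_atTop]
  intro ε hε
  -- The factor 1 - α makes the accumulated errors, a geometric series, sum to at most ε / 2.
  obtain ⟨N, hN⟩ := Metric.tendsto_atTop.1 hy (ε / 2 * (1 - α)) (by positivity)
  have hb : ∀ k, |x (N + k) - b / (1 - α)| ≤ α ^ k * |x N - b / (1 - α)| + ε / 2 := by
    intro k
    induction k with
    | zero => simp; linarith
    | succ k ih =>
      have h2 : x (N + (k + 1)) - b / (1 - α) =
          α * (x (N + k) - b / (1 - α)) + (y (N + k) - b) := by
        rw [← add_assoc, hx]; field_simp; ring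
      have h3 := hN (N + k) (by omega)
      rw [Real.dist_eq] at h3
      rw [h2]
      calc _ ≤ |α * (x (N + k) - b / (1 - α))| + |y (N + k) - b| := abs_add_le _ _
        _ ≤ α * (α ^ k * |x N - b / (1 - α)| + ε / 2) + ε / 2 * (1 - α) := by
          rw [abs_mul, abs_of_nonneg h0]
          gcongr
        _ = _ := by ring
  have hlim : Tendsto (fun k => α ^ k * |x N - b / (1 - α)|) atTop (𝓝 0) := by
    simpa using (tendsto_pow_atTop_nhds_zero_of_lt_one h0 h1).mul_const |x N - b / (1 - α)|
  obtain ⟨K, hK⟩ := eventually_atTop.1 (hlim.eventually (gt_mem_nhds (half_pos hε)))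
  refine ⟨N + K, fun n hn => ?_⟩
  obtain ⟨k, rfl⟩ := Nat.exists_eq_add_of_le (show N ≤ n by omega)
  rw [Real.dist_eq]
  linarith [hb k, hK k (by omega)]

/-- The part of the recursion for the `j`-th moment that depends only on the lower moments. -/
noncomputable def remainder (w : ℕ → ℕ → ℝ) (a : ℕ → ℝ) (j : ℕ) : ℝ :=
  ∑ r ∈ Icc 2 j, redPow a r j * w 0 r +
    ∑ i ∈ range j, (j.choose i : ℝ) * ∑ r ∈ range (i + 1), redPow a r i * w (j - i) r

/-- The recursion satisfied by the moments `x n j`, `j ≤ ℓ`, of the number of marked nodes, where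
`w a r` stands for the mixed moments of the mark and the number of children of the root. -/
structure MomentRecursion (ℓ : ℕ) (w x : ℕ → ℕ → ℝ) : Prop where
  weight_nonneg : ∀ a r, 0 ≤ w a r
  weight_zero_two : 2 ≤ ℓ → 0 < w 0 2
  nonneg : ∀ n j, 0 ≤ x n j
  zero_right : ∀ n, x n 0 = 1
  zero_left : ∀ j, 1 ≤ j → x 0 j = 0
  mono : ∀ n m, n ≤ m → ∀ j ≤ ℓ, x n j ≤ x m j
  pos : ∀ j, 1 ≤ j → j ≤ ℓ → 0 < x 1 j
  step : ∀ n j, j ≤ ℓ → x (n + 1) j = ∑ i ∈ range (j + 1), (j.choose i : ℝ) *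
    ∑ r ∈ range (i + 1), redPow (x n) r i * w (j - i) r

theorem sum_range_succ_eq_Icc {g : ℕ → ℝ} {j : ℕ} (hj : 1 ≤ j) (h0 : g 0 = 0) :
    ∑ r ∈ range (j + 1), g r = g 1 + ∑ r ∈ Icc 2 j, g r := by
  rw [show range (j + 1) = insert 0 (insert 1 (Icc 2 j)) by
    ext; simp; omega]
  rw [sum_insert (by simp), sum_insert (by simp), h0, zero_add]

theorem remainder_le_remainder {w : ℕ → ℕ → ℝ} (hw : ∀ a r, 0 ≤ w a r) {a b : ℕ → ℝ} {j : ℕ}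
    (ha : ∀ t, 0 ≤ a t) (h : ∀ t, 1 ≤ t → t < j → a t ≤ b t) :
    remainder w a j ≤ remainder w b j := by
  refine add_le_add (sum_le_sum fun r hr => mul_le_mul_of_nonneg_right ?_ (hw _ _))
    (sum_le_sum fun i hi => mul_le_mul_of_nonneg_left (sum_le_sum fun r _ =>
      mul_le_mul_of_nonneg_right ?_ (hw _ _)) (by positivity))
  · exact redPow_le_redPow_of_two_le ha h (mem_Icc.1 hr).1
  · exact redPow_le_redPow ha (fun t h1 h2 => h t h1 (h2.trans_lt (mem_range.1 hi))) r

theorem tendsto_remainder {w : ℕ → ℕ → ℝ} {a : ℕ → ℕ → ℝ} {b : ℕ → ℝ} {j : ℕ}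
    (h : ∀ t < j, Tendsto (fun n => a n t) atTop (𝓝 (b t))) :
    Tendsto (fun n => remainder w (a n) j) atTop (𝓝 (remainder w b j)) := by
  refine (tendsto_finsetSum _ fun r hr => ?_).add
    (tendsto_finsetSum _ fun i hi => (tendsto_finsetSum _ fun r _ => ?_).const_mul _)
  · exact (tendsto_redPow_of_two_le h (mem_Icc.1 hr).1).mul_const _
  · exact (tendsto_redPow (fun t ht => h t (ht.trans_lt (mem_range.1 hi))) r).mul_const _

theorem tendsto_sum_zero {ι κ : Type*} {s : Finset ι} {F : Filter κ} {g : ι → κ → ℝ}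
    (h : ∀ i ∈ s, Tendsto (g i) F (𝓝 0)) : Tendsto (fun n => ∑ i ∈ s, g i n) F (𝓝 0) := by
  simpa using tendsto_finsetSum s h

theorem redPow_div_pow (x : ℕ → ℕ → ℝ) (μ : ℝ) (n r i : ℕ) :
    redPow (fun t => x n t / μ ^ (t * n)) r i = redPow (x n) r i / μ ^ (i * n) := by
  have h := redPow_homogeneous (x n) ((μ ^ n)⁻¹) 1 r i
  have h' : (fun t => (μ ^ n)⁻¹ ^ t * 1 * x n t) = fun t => x n t / μ ^ (t * n) := by
    funext t
    rw [mul_comm t n, pow_mul, inv_pow, mul_one, div_eq_inv_mul]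
  rw [h'] at h
  rw [h, mul_comm i n, pow_mul, inv_pow, one_pow, mul_one, div_eq_inv_mul]

theorem sq_pow_succ_mul_inv {n : ℕ} (hn : 1 ≤ n) (k : ℕ) :
    ((n : ℝ) ^ 2) ^ (k + 1) * (n : ℝ)⁻¹ = (n : ℝ) ^ (2 * k + 1) := by
  have hn0 : (n : ℝ) ≠ 0 := by positivity
  rw [← pow_mul, show 2 * (k + 1) = 2 * k + 1 + 1 by ring, pow_succ (n : ℝ) (2 * k + 1), mul_assoc,
    mul_inv_cancel₀ hn0, mul_one]

/-- A coefficient of total order i grows at most like μ^(in), so normalizing by the larger power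
μ^(jn) leaves a factor μ^(-(j-i)n). -/
theorem tendsto_redPow_div_pow {x : ℕ → ℕ → ℝ} {μ : ℝ} (hμ : 1 < μ) {i j : ℕ} (hij : i < j) {b : ℕ → ℝ}
    (h : ∀ t ≤ i, Tendsto (fun n => x n t / μ ^ (t * n)) atTop (𝓝 (b t))) (r : ℕ) :
    Tendsto (fun n => redPow (x n) r i / μ ^ (j * n)) atTop (𝓝 0) := by
  have h1 := tendsto_redPow h r
  obtain ⟨k, rfl⟩ := Nat.exists_eq_add_of_lt hij
  have h2 : Tendsto (fun n => (μ ^ (k + 1))⁻¹ ^ n) atTop (𝓝 0) :=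
    tendsto_pow_atTop_nhds_zero_of_lt_one (by positivity)
      (inv_lt_one_of_one_lt₀ (one_lt_pow₀ hμ (by omega)))
  have h3 := h1.mul h2
  rw [mul_zero] at h3
  refine h3.congr fun n => ?_
  rw [redPow_div_pow, inv_pow, ← pow_mul, ← div_eq_mul_inv, div_div, ← pow_add, ← add_mul,
    add_assoc]

namespace MomentRecursion

variable {ℓ : ℕ} {w x : ℕ → ℕ → ℝ} (hx : MomentRecursion ℓ w x)
include hx

/-- The moment of order j itself enters the right-hand side only through i = j, r = 1; the term i =
j, r = 0 vanishes. -/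
theorem step_remainder (n : ℕ) {j : ℕ} (hj : 1 ≤ j) (hjℓ : j ≤ ℓ) :
    x (n + 1) j = w 0 1 * x n j + remainder w (x n) j := by
  rw [hx.step n j hjℓ, sum_range_succ, remainder, Nat.choose_self, Nat.sub_self,
    sum_range_succ_eq_Icc hj (by rw [redPow_zero_of_pos _ hj, zero_mul]), redPow_one _ hj]
  push_cast
  ring

theorem remainder_one (n : ℕ) (hℓ : 1 ≤ ℓ) : remainder w (x n) 1 = x 1 1 := by
  have h := hx.step_remainder 0 le_rfl hℓ
  rw [hx.zero_left 1 le_rfl, mul_zero, zero_add] at h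
  have h' : ∀ n, remainder w (x n) 1 = w 1 0 := fun n => by
    simp [remainder, redPow_zero]
  rw [h', h, zero_add, h']

theorem pos_of_pos {n j : ℕ} (hn : 1 ≤ n) (hj : 1 ≤ j) (hjℓ : j ≤ ℓ) : 0 < x n j :=
  (hx.pos j hj hjℓ).trans_le (hx.mono 1 n hn j hjℓ)

theorem exists_tendsto_of_lt_one (hμ : w 0 1 < 1) {j : ℕ} (hj : j ≤ ℓ) :
    ∃ b, Tendsto (fun n => x n j) atTop (𝓝 b) := by
  induction j using Nat.strong_induction_on with
  | _ j ih =>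
    rcases Nat.eq_zero_or_pos j with rfl | hj0
    · exact ⟨1, by simp only [hx.zero_right]; exact tendsto_const_nhds⟩
    · have h : ∀ t, ∃ b, t < j → Tendsto (fun n => x n t) atTop (𝓝 b) := fun t => by
        by_cases ht : t < j
        · exact (ih t ht (ht.le.trans hj)).imp fun b hb _ => hb
        · exact ⟨0, fun h => absurd h ht⟩
      choose b hb using h
      exact ⟨_, tendsto_of_affine_recursion (hx.weight_nonneg 0 1) hμ
        (fun n => hx.step_remainder n hj0 hj) (tendsto_remainder hb)⟩

/-! ### Moments when μ > 1. -/

section Supercritical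

variable {ω : ℕ → ℝ}

/-- For j = 1 the normalized recursion has factor 1 and is not a contraction, so the moments are
computed in closed form. -/
theorem tendsto_div_pow_one (hμ : 1 < w 0 1) (hℓ : 1 ≤ ℓ) :
    Tendsto (fun n => x n 1 / w 0 1 ^ n) atTop (𝓝 (x 1 1 / (w 0 1 - 1))) := by
  have h0 : 0 < w 0 1 := by linarith
  have h1 : w 0 1 - 1 ≠ 0 := by linarith
  have hform : ∀ n, x n 1 = x 1 1 / (w 0 1 - 1) * (w 0 1 ^ n - 1) := by
    intro n
    induction n with
    | zero => simp [hx.zero_left]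
    | succ n ih =>
      rw [hx.step_remainder n le_rfl hℓ, hx.remainder_one n hℓ, ih]
      field_simp
      ring
  have h : ∀ n, x n 1 / w 0 1 ^ n = x 1 1 / (w 0 1 - 1) * (1 - (w 0 1)⁻¹ ^ n) := by
    intro n
    rw [hform, inv_pow]
    field_simp
  simp only [h]
  simpa using ((tendsto_pow_atTop_nhds_zero_of_lt_one (by positivity)
    (inv_lt_one_of_one_lt₀ hμ)).const_sub 1).const_mul (x 1 1 / (w 0 1 - 1))

/-- Dividing the recursion by μ^(j(n+1)) gives a contraction of factor μ^(1-j). In the remainder,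
the terms with i < j become negligible and those with i = j, r ≥ 2 converge by induction to the
numerator of ω_j. -/
theorem tendsto_div_pow (hμ : 1 < w 0 1) (hω0 : ω 0 = 1) (hω1 : ω 1 = x 1 1 / (w 0 1 - 1))
    (hω : ∀ j, 2 ≤ j → j ≤ ℓ →
      ω j = (∑ r ∈ Icc 2 j, redPow ω r j * w 0 r) / (w 0 1 ^ j - w 0 1)) {j : ℕ} (hj : j ≤ ℓ) :
    Tendsto (fun n => x n j / w 0 1 ^ (j * n)) atTop (𝓝 (ω j)) := by
  have h0 : 0 < w 0 1 := by linarith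
  induction j using Nat.strong_induction_on with
  | _ j ih =>
    rcases Nat.lt_or_ge j 2 with hj2 | hj2
    · interval_cases j
      · simp [hx.zero_right, hω0]
      · simpa [hω1] using hx.tendsto_div_pow_one hμ hj
    · have ih' : ∀ t < j, Tendsto (fun n => x n t / w 0 1 ^ (t * n)) atTop (𝓝 (ω t)) :=
        fun t ht => ih t ht (ht.le.trans hj)
      obtain ⟨k, rfl⟩ := Nat.exists_eq_add_of_le hj2
      have hrem : Tendsto (fun n => remainder w (x n) (2 + k) / w 0 1 ^ ((2 + k) * n)) atTop
          (𝓝 (∑ r ∈ Icc 2 (2 + k), redPow ω r (2 + k) * w 0 r)) := by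
        have h1 : Tendsto (fun n => ∑ r ∈ Icc 2 (2 + k), redPow (x n) r (2 + k) * w 0 r /
            w 0 1 ^ ((2 + k) * n)) atTop (𝓝 (∑ r ∈ Icc 2 (2 + k), redPow ω r (2 + k) * w 0 r)) := by
          refine tendsto_finsetSum _ fun r hr => ?_
          have := (tendsto_redPow_of_two_le ih' (mem_Icc.1 hr).1).mul_const (w 0 r)
          refine this.congr fun n => ?_
          rw [redPow_div_pow]
          ring
        have h2 : Tendsto (fun n => ∑ i ∈ range (2 + k), ∑ r ∈ range (i + 1),
            ((2 + k).choose i : ℝ) * (redPow (x n) r i * w (2 + k - i) r) /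
            w 0 1 ^ ((2 + k) * n)) atTop (𝓝 0) := by
          refine tendsto_sum_zero fun i hi => ?_
          refine tendsto_sum_zero fun r _ => ?_
          have hi := mem_range.1 hi
          have := (tendsto_redPow_div_pow hμ hi
            (fun t ht => ih' t (ht.trans_lt hi)) r).const_mul
              (((2 + k).choose i : ℝ) * w (2 + k - i) r)
          rw [mul_zero] at this
          exact this.congr fun n => by ring
        have h := h1.add h2
        rw [add_zero] at h
        refine h.congr fun n => ?_
        simp only [remainder, add_div, sum_div, mul_sum]
      have hrec : ∀ n, x (n + 1) (2 + k) / w 0 1 ^ ((2 + k) * (n + 1)) =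
          (w 0 1)⁻¹ ^ (1 + k) * (x n (2 + k) / w 0 1 ^ ((2 + k) * n)) +
          (w 0 1)⁻¹ ^ (2 + k) * (remainder w (x n) (2 + k) / w 0 1 ^ ((2 + k) * n)) := by
        intro n
        rw [hx.step_remainder n (by omega) hj, mul_add, pow_add _ ((2 + k) * n), mul_one,
          inv_pow, inv_pow]
        field_simp
        ring
      have hlt : (w 0 1)⁻¹ ^ (1 + k) < 1 :=
        pow_lt_one₀ (by positivity) (inv_lt_one_of_one_lt₀ hμ) (by omega)
      have := tendsto_of_affine_recursion
        (x := fun n => x n (2 + k) / w 0 1 ^ ((2 + k) * n)) (by positivity) hlt hrec (hrem.const_mul _)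
      convert this using 2
      have h1 : w 0 1 ^ (1 + k) - 1 ≠ 0 :=
        (sub_pos.2 (one_lt_pow₀ hμ (by omega))).ne'
      have h2 : w 0 1 ^ (2 + k) - w 0 1 = w 0 1 * (w 0 1 ^ (1 + k) - 1) := by ring
      rw [hω _ hj2 hj, h2, inv_pow, inv_pow]
      have h3 : 1 - (w 0 1 ^ (1 + k))⁻¹ = (w 0 1 ^ (1 + k) - 1) / w 0 1 ^ (1 + k) := by
        field_simp
      rw [h3, show 2 + k = 1 + k + 1 by ring, pow_succ]
      field_simp

theorem limit_pos (hμ : 1 < w 0 1) (hω1 : ω 1 = x 1 1 / (w 0 1 - 1))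
    (hω : ∀ j, 2 ≤ j → j ≤ ℓ →
      ω j = (∑ r ∈ Icc 2 j, redPow ω r j * w 0 r) / (w 0 1 ^ j - w 0 1)) {j : ℕ} (hj1 : 1 ≤ j)
    (hj : j ≤ ℓ) : 0 < ω j := by
  induction j using Nat.strong_induction_on with
  | _ j ih =>
    rcases hj1.eq_or_lt with rfl | hj2
    · rw [hω1]
      exact div_pos (hx.pos 1 le_rfl hj) (by linarith)
    · have hj2 : 2 ≤ j := hj2
      rw [hω j hj2 hj]
      have hpow : w 0 1 < w 0 1 ^ j := lt_self_pow₀ hμ (by omega)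
      refine div_pos ?_ (by linarith)
      -- Only indices between 1 and j - 1 matter when r ≥ 2. Setting the other values to 1 gives a
      -- sequence positive everywhere, as the positivity lemmas require.
      have hcongr : ∀ r, 2 ≤ r → redPow ω r j =
          redPow (fun t => if 1 ≤ t ∧ t < j then ω t else 1) r j := fun r hr => by
        have h : ∀ a : ℕ → ℝ, redPow a r j = redPow (fun t => if t = 0 then 1 else a t) r j :=
          fun a => by
            unfold redPow
            congr 1
            funext t
            by_cases h0 : t = 0 <;> simp [h0]
        rw [h]
        refine redPow_congr_of_two_le (fun t ht => ?_) hr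
        by_cases h0 : t = 0
        · simp [h0]
        · rw [if_neg h0, if_pos ⟨by omega, ht⟩]
      have hpos : ∀ t, 0 < (fun t => if 1 ≤ t ∧ t < j then ω t else 1) t := fun t => by
        dsimp only
        split_ifs with h
        exacts [ih t h.2 h.1 (h.2.le.trans hj), one_pos]
      refine sum_pos' (fun r hr => ?_) ⟨2, mem_Icc.2 ⟨le_rfl, hj2⟩, ?_⟩
      · rw [hcongr r (mem_Icc.1 hr).1]
        exact mul_nonneg (redPow_nonneg (fun t => (hpos t).le) _ _) (hx.weight_nonneg _ _)
      · rw [hcongr 2 le_rfl]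
        exact mul_pos (redPow_pos (fun t => (hpos t).le) (fun t _ _ => hpos t) (by omega) hj2)
          (hx.weight_zero_two (hj2.trans hj))

end Supercritical

/-! ### Moments when μ = 1: the exact order n^(2j-1). -/

section Critical

/-- By homogeneity a term (i, r) is of order n^(2i-r). Either i = k + 1 and r ≥ 2, or i ≤ k; in both
cases this is at most n^(2k). -/
theorem remainder_le_of_le {A : ℝ} (hA : 0 ≤ A) {n k : ℕ} (hn : 1 ≤ n)
    (h : ∀ t, 1 ≤ t → t < k + 1 → x n t ≤ ((n : ℝ) ^ 2) ^ t * (n : ℝ)⁻¹ * A) :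
    remainder w (x n) (k + 1) ≤ ((n : ℝ) ^ 2) ^ k * remainder w (fun _ => A) (k + 1) := by
  have hn' : (1 : ℝ) ≤ n := by exact_mod_cast hn
  have hn0 : (n : ℝ) ≠ 0 := by positivity
  have hred : ∀ r i, 0 ≤ redPow (fun _ => A) r i := redPow_nonneg fun _ => hA
  refine (remainder_le_remainder hx.weight_nonneg (hx.nonneg n) h).trans ?_
  simp only [remainder, redPow_homogeneous, mul_add, mul_sum]
  refine add_le_add (sum_le_sum fun r hr => ?_) (sum_le_sum fun i hi => sum_le_sum fun r _ => ?_)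
  · have hr := (mem_Icc.1 hr).1
    have h1 : ((n : ℝ) ^ 2) ^ (k + 1) * (n : ℝ)⁻¹ ^ r ≤ ((n : ℝ) ^ 2) ^ k := by
      rw [pow_succ, mul_assoc]
      refine mul_le_of_le_one_right (by positivity) ?_
      calc (n : ℝ) ^ 2 * (n : ℝ)⁻¹ ^ r ≤ (n : ℝ) ^ 2 * (n : ℝ)⁻¹ ^ 2 :=
            mul_le_mul_of_nonneg_left (pow_le_pow_of_le_one (by positivity)
              (inv_le_one_of_one_le₀ hn') hr) (by positivity)
        _ = 1 := by rw [← mul_pow, mul_inv_cancel₀ hn0, one_pow]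
    rw [← mul_assoc]
    exact mul_le_mul_of_nonneg_right (mul_le_mul_of_nonneg_right h1 (hred _ _))
      (hx.weight_nonneg _ _)
  · have hi := mem_range.1 hi
    have h1 : ((n : ℝ) ^ 2) ^ i * (n : ℝ)⁻¹ ^ r ≤ ((n : ℝ) ^ 2) ^ k :=
      (mul_le_of_le_one_right (by positivity) (pow_le_one₀ (by positivity)
        (inv_le_one_of_one_le₀ hn'))).trans
        (pow_le_pow_right₀ (one_le_pow₀ hn') (by omega))
    have h2 := mul_le_mul_of_nonneg_right (mul_le_mul_of_nonneg_right h1 (hred r i))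
      (hx.weight_nonneg (k + 1 - i) r)
    have h3 := mul_le_mul_of_nonneg_left h2 (Nat.cast_nonneg (α := ℝ) ((k + 1).choose i))
    linarith

/-- The bound is n^(2t-1) A, written in the form to which `redPow_homogeneous` applies. With μ = 1
the moment of order k + 1 is a running sum of remainders of order n^(2k), hence of order n^(2k+1).
-/
theorem exists_upper_bound (hμ : w 0 1 = 1) (j : ℕ) (hj : j ≤ ℓ) :
    ∃ A : ℝ, 0 ≤ A ∧ ∀ t, 1 ≤ t → t ≤ j → ∀ n : ℕ, 1 ≤ n →
      x n t ≤ ((n : ℝ) ^ 2) ^ t * (n : ℝ)⁻¹ * A := by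
  induction j with
  | zero => exact ⟨0, le_rfl, fun t h1 h2 => by omega⟩
  | succ k ih =>
    obtain ⟨A, hA, hb⟩ := ih (by omega)
    set C := max (x 1 (k + 1)) (remainder w (fun _ => A) (k + 1)) with hC
    have hC0 : 0 ≤ C := (hx.nonneg 1 (k + 1)).trans (le_max_left _ _)
    refine ⟨max A C, hA.trans (le_max_left _ _), fun t h1 h2 n hn => ?_⟩
    rcases Nat.lt_or_ge t (k + 1) with ht | ht
    · exact (hb t h1 (by omega) n hn).trans
        (mul_le_mul_of_nonneg_left (le_max_left _ _) (by positivity))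
    · obtain rfl : t = k + 1 := by omega
      refine le_trans ?_ (mul_le_mul_of_nonneg_left (le_max_right A C) (by positivity))
      rw [sq_pow_succ_mul_inv hn]
      induction n, hn using Nat.le_induction with
      | base => simp [hC]
      | succ n hn ih' =>
        have h3 := hx.remainder_le_of_le (k := k) hA hn fun t h1 h2 => hb t h1 (by omega) n hn
        have h4 : ((n : ℝ) ^ 2) ^ k * remainder w (fun _ => A) (k + 1) ≤ ((n : ℝ) ^ 2) ^ k * C :=
          mul_le_mul_of_nonneg_left (le_max_right _ _) (by positivity)
        rw [hx.step_remainder n (by omega) hj, hμ]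
        have h5 : (n : ℝ) ^ (2 * k) ≤ ((n + 1 : ℕ) : ℝ) ^ (2 * k) := by gcongr; simp
        have h6 : (n : ℝ) ^ (2 * k) * (n + 1) * C ≤ ((n + 1 : ℕ) : ℝ) ^ (2 * k) * (n + 1) * C := by
          gcongr
        rw [← pow_mul] at h3 h4
        rw [pow_succ] at ih' ⊢
        push_cast at h6 ⊢
        nlinarith

/-- The increments of the moment of order k + 1 are bounded below by a multiple of n^(2k), obtained
for k ≥ 1 from the product of the moments of orders 1 and k. -/
theorem exists_lower_bound (hμ : w 0 1 = 1) (j : ℕ) (hj : j ≤ ℓ) :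
    ∃ a : ℝ, 0 < a ∧ ∀ t, 1 ≤ t → t ≤ j → ∀ n : ℕ, 1 ≤ n →
      ((n : ℝ) ^ 2) ^ t * (n : ℝ)⁻¹ * a ≤ x n t := by
  induction j with
  | zero => exact ⟨1, one_pos, fun t h1 h2 => by omega⟩
  | succ k ih =>
    obtain ⟨a, ha, hb⟩ := ih (by omega)
    suffices ∃ b : ℝ, 0 < b ∧ ∀ n : ℕ, 1 ≤ n → (n : ℝ) ^ (2 * k + 1) * b ≤ x n (k + 1) by
      obtain ⟨b, hb0, hb'⟩ := this
      refine ⟨min a b, lt_min ha hb0, fun t h1 h2 n hn => ?_⟩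
      rcases Nat.lt_or_ge t (k + 1) with ht | ht
      · exact (mul_le_mul_of_nonneg_left (min_le_left _ _) (by positivity)).trans
          (hb t h1 (by omega) n hn)
      · obtain rfl : t = k + 1 := by omega
        rw [sq_pow_succ_mul_inv hn]
        exact (mul_le_mul_of_nonneg_left (min_le_right _ _) (by positivity)).trans (hb' n hn)
    obtain ⟨d, hd, hrem⟩ : ∃ d : ℝ, 0 < d ∧ ∀ n : ℕ, 1 ≤ n →
        (n : ℝ) ^ (2 * k) * d ≤ remainder w (x n) (k + 1) := by
      rcases Nat.eq_zero_or_pos k with rfl | hk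
      · exact ⟨x 1 1, hx.pos 1 le_rfl hj, fun n _ => by simp [hx.remainder_one n hj]⟩
      · refine ⟨a * a * w 0 2, mul_pos (mul_pos ha ha) (hx.weight_zero_two (by omega)), fun n hn => ?_⟩
        have h1 := hb 1 le_rfl hk n hn
        have h2 := hb k hk le_rfl n hn
        obtain ⟨k, rfl⟩ := Nat.exists_eq_add_of_le' hk
        have h3 := mul_le_redPow_two (hx.nonneg n) (show 2 ≤ k + 1 + 1 by omega)
        rw [Nat.add_sub_cancel] at h3
        rw [sq_pow_succ_mul_inv hn] at h2
        have h1' : (n : ℝ) * a ≤ x n 1 := by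
          have := sq_pow_succ_mul_inv hn 0
          simp only [zero_add, mul_zero] at this
          rw [this, pow_one] at h1
          exact h1
        have h4 : (n : ℝ) * a * ((n : ℝ) ^ (2 * k + 1) * a) ≤ redPow (x n) 2 (k + 1 + 1) :=
          (mul_le_mul h1' h2 (by positivity) (hx.nonneg _ _)).trans h3
        calc (n : ℝ) ^ (2 * (k + 1)) * (a * a * w 0 2)
            = (n : ℝ) * a * ((n : ℝ) ^ (2 * k + 1) * a) * w 0 2 := by ring
          _ ≤ redPow (x n) 2 (k + 1 + 1) * w 0 2 :=
            mul_le_mul_of_nonneg_right h4 (hx.weight_nonneg _ _)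
          _ ≤ ∑ r ∈ Icc 2 (k + 1 + 1), redPow (x n) r (k + 1 + 1) * w 0 r :=
            single_le_sum (f := fun r => redPow (x n) r (k + 1 + 1) * w 0 r)
              (fun r _ => mul_nonneg (redPow_nonneg (hx.nonneg n) _ _) (hx.weight_nonneg _ _))
              (mem_Icc.2 ⟨le_rfl, by omega⟩)
          _ ≤ _ := le_add_of_nonneg_right (sum_nonneg fun i _ => mul_nonneg (by positivity)
              (sum_nonneg fun r _ => mul_nonneg (redPow_nonneg (hx.nonneg n) _ _)
                (hx.weight_nonneg _ _)))
    -- A crude bound for (n + 1)^(m+1) - n^(m+1). With m = 2k it shows that an increment d n^(2k)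
    -- sustains growth b n^(2k+1) as soon as 4^(2k+1) b ≤ d.
    have hpow : ∀ (n : ℕ), 1 ≤ n → ∀ m : ℕ,
        ((n : ℝ) + 1) ^ (m + 1) ≤ (n : ℝ) ^ (m + 1) + 4 ^ (m + 1) * (n : ℝ) ^ m := by
      intro n hn m
      have hn' : (1 : ℝ) ≤ n := by exact_mod_cast hn
      induction m with
      | zero => simp
      | succ m ih =>
        have h1 : (0 : ℝ) < (n : ℝ) ^ m := by positivity
        have h2 : (1 : ℝ) ≤ 4 ^ (m + 1) := one_le_pow₀ (by norm_num)
        have h3 := mul_le_mul_of_nonneg_right ih (show (0 : ℝ) ≤ n + 1 by positivity)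
        have h4 : (n : ℝ) ^ m ≤ n ^ m * n := le_mul_of_one_le_right h1.le hn'
        have h5 := mul_le_mul_of_nonneg_left h4 (show (0 : ℝ) ≤ 4 ^ (m + 1) by positivity)
        have h6 : (n : ℝ) ^ m * n ≤ 4 ^ (m + 1) * (n ^ m * n) :=
          le_mul_of_one_le_left (by positivity) h2
        have h7 : (0 : ℝ) ≤ 4 ^ (m + 1) * (n ^ m * n) := by positivity
        rw [pow_succ _ (m + 1), pow_succ (n : ℝ) (m + 1), pow_succ (4 : ℝ) (m + 1)]
        rw [pow_succ (n : ℝ) m] at h3 ⊢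
        linarith
    refine ⟨min (x 1 (k + 1)) (d / 4 ^ (2 * k + 1)),
      lt_min (hx.pos _ (by omega) hj) (by positivity), fun n hn => ?_⟩
    set b := min (x 1 (k + 1)) (d / 4 ^ (2 * k + 1)) with hbdef
    have hb0 : 0 < b := lt_min (hx.pos _ (by omega) hj) (by positivity)
    have hbd : 4 ^ (2 * k + 1) * b ≤ d := by
      have : b ≤ d / 4 ^ (2 * k + 1) := min_le_right _ _
      rw [le_div_iff₀ (by positivity)] at this
      linarith
    induction n, hn using Nat.le_induction with
    | base => simp [hbdef]
    | succ n hn ih' =>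
      rw [hx.step_remainder n (by omega) hj, hμ, one_mul]
      have h1 := mul_le_mul_of_nonneg_right (hpow n hn (2 * k)) hb0.le
      have h2 := mul_le_mul_of_nonneg_left hbd (show (0 : ℝ) ≤ (n : ℝ) ^ (2 * k) by positivity)
      have h3 := hrem n hn
      push_cast
      linarith

/-- Apart from the excluded pair, the numerator is at most of order n^(2ℓ-2), one power below the
denominator. -/
theorem tendsto_redPow_div_of_eq_one (hμ : w 0 1 = 1) (hℓ : 1 ≤ ℓ) (n : ℕ) {i r : ℕ}
    (hi : i ≤ ℓ) (h : ¬ (i = ℓ ∧ r = 1)) :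
    Tendsto (fun m => redPow (x m) r i / x (n + m) ℓ) atTop (𝓝 0) := by
  -- These coefficients are identically zero. Removing them ensures that i = ℓ forces r ≥ 2 below.
  by_cases h0 : i ≠ 0 ∧ r = 0
  · simp [h0.2, redPow_zero_of_pos _ (Nat.one_le_iff_ne_zero.2 h0.1)]
  obtain ⟨A, hA, hup⟩ := hx.exists_upper_bound hμ ℓ le_rfl
  obtain ⟨a, ha, hlow⟩ := hx.exists_lower_bound hμ ℓ le_rfl
  obtain ⟨k, rfl⟩ := Nat.exists_eq_add_of_le' hℓ
  have hC := redPow_nonneg (fun _ => hA) r i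
  have hbound : ∀ᶠ m : ℕ in atTop, redPow (x m) r i / x (n + m) (k + 1) ≤
      redPow (fun _ => A) r i / a * (m : ℝ)⁻¹ := by
    filter_upwards [eventually_ge_atTop 1] with m hm
    have hm' : (1 : ℝ) ≤ m := by exact_mod_cast hm
    have hm0 : (m : ℝ) ≠ 0 := by positivity
    have h1 : redPow (x m) r i ≤ (m : ℝ) ^ (2 * k) * redPow (fun _ => A) r i := by
      have h2 : redPow (x m) r i ≤ ((m : ℝ) ^ 2) ^ i * (m : ℝ)⁻¹ ^ r * redPow (fun _ => A) r i := by
        rw [← redPow_homogeneous]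
        exact redPow_le_redPow (hx.nonneg m) (fun t h1 h2 => hup t h1 (h2.trans hi) m hm) r
      refine h2.trans (mul_le_mul_of_nonneg_right ?_ hC)
      rw [← pow_mul]
      rcases Nat.lt_or_ge i (k + 1) with hik | hik
      · exact (mul_le_of_le_one_right (by positivity) (pow_le_one₀ (by positivity)
          (inv_le_one_of_one_le₀ hm'))).trans (pow_le_pow_right₀ hm' (by omega))
      · obtain rfl : i = k + 1 := by omega
        calc (m : ℝ) ^ (2 * (k + 1)) * (m : ℝ)⁻¹ ^ r
            ≤ (m : ℝ) ^ (2 * (k + 1)) * (m : ℝ)⁻¹ ^ 2 :=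
              mul_le_mul_of_nonneg_left (pow_le_pow_of_le_one (by positivity)
                (inv_le_one_of_one_le₀ hm') (by omega)) (by positivity)
          _ = (m : ℝ) ^ (2 * k) := by
            rw [show 2 * (k + 1) = 2 * k + 2 by ring, pow_add, mul_assoc, ← mul_pow,
              mul_inv_cancel₀ hm0, one_pow, mul_one]
    have h2 : (m : ℝ) ^ (2 * k + 1) * a ≤ x (n + m) (k + 1) := by
      rw [← sq_pow_succ_mul_inv hm]
      exact (hlow _ (by omega) le_rfl m hm).trans (hx.mono m (n + m) (by omega) _ le_rfl)
    calc redPow (x m) r i / x (n + m) (k + 1)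
        ≤ ((m : ℝ) ^ (2 * k) * redPow (fun _ => A) r i) / ((m : ℝ) ^ (2 * k + 1) * a) :=
          div_le_div₀ (by positivity) h1 (by positivity) h2
      _ = _ := by rw [pow_succ]; field_simp
  refine tendsto_of_tendsto_of_tendsto_of_le_of_le' tendsto_const_nhds ?_
    (Eventually.of_forall fun m => div_nonneg (redPow_nonneg (hx.nonneg m) _ _) (hx.nonneg _ _))
    hbound
  simpa using (tendsto_inv_atTop_nhds_zero_nat (𝕜 := ℝ)).const_mul (redPow (fun _ => A) r i / a)

theorem tendsto_remainder_div_of_eq_one (hμ : w 0 1 = 1) (hℓ : 1 ≤ ℓ) :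
    Tendsto (fun m => remainder w (x m) ℓ / x m ℓ) atTop (𝓝 0) := by
  have h1 : Tendsto (fun m => ∑ r ∈ Icc 2 ℓ, redPow (x m) r ℓ * w 0 r / x m ℓ) atTop (𝓝 0) := by
    refine tendsto_sum_zero fun r hr => ?_
    have hr := mem_Icc.1 hr
    have := (hx.tendsto_redPow_div_of_eq_one hμ hℓ 0 (i := ℓ) (r := r) le_rfl
      (by omega)).const_mul (w 0 r)
    simp only [mul_zero, zero_add] at this
    exact this.congr fun n => by ring
  have h2 : Tendsto (fun m => ∑ i ∈ range ℓ, ∑ r ∈ range (i + 1),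
      (ℓ.choose i : ℝ) * (redPow (x m) r i * w (ℓ - i) r) / x m ℓ) atTop (𝓝 0) := by
    refine tendsto_sum_zero fun i hi => ?_
    refine tendsto_sum_zero fun r _ => ?_
    have hi := mem_range.1 hi
    have := (hx.tendsto_redPow_div_of_eq_one hμ hℓ 0 (i := i) (r := r) hi.le
      (by omega)).const_mul ((ℓ.choose i : ℝ) * w (ℓ - i) r)
    simp only [mul_zero, zero_add] at this
    exact this.congr fun n => by ring
  have h := h1.add h2
  rw [add_zero] at h
  refine h.congr fun n => ?_
  simp only [remainder, add_div, sum_div, mul_sum]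

/-- Consecutive ratios tend to 1 since the remainder is negligible; n of them are multiplied
together. -/
theorem tendsto_div_add_of_eq_one (hμ : w 0 1 = 1) (hℓ : 1 ≤ ℓ) (n : ℕ) :
    Tendsto (fun m => x m ℓ / x (n + m) ℓ) atTop (𝓝 1) := by
  have hpos : ∀ᶠ m in atTop, 0 < x m ℓ := by
    filter_upwards [eventually_ge_atTop 1] with m hm using hx.pos_of_pos hm hℓ le_rfl
  induction n with
  | zero =>
    refine tendsto_const_nhds.congr' ?_
    filter_upwards [hpos] with m hm
    rw [zero_add, div_self hm.ne']
  | succ n ih =>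
    have h1 : Tendsto (fun m => x (m + 1) ℓ / x m ℓ) atTop (𝓝 1) := by
      have := (hx.tendsto_remainder_div_of_eq_one hμ hℓ).const_add 1
      rw [add_zero] at this
      refine this.congr' ?_
      filter_upwards [hpos] with m hm
      rw [hx.step_remainder m hℓ le_rfl, hμ, one_mul, add_div, div_self hm.ne']
    have h2 : Tendsto (fun m => x (n + m + 1) ℓ / x (n + m) ℓ) atTop (𝓝 1) :=
      h1.comp (tendsto_add_atTop_iff_nat n |>.2 tendsto_id |>.congr fun m => by simp [add_comm])
    have h3 := ih.div h2 one_ne_zero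
    rw [div_one] at h3
    refine h3.congr' ?_
    filter_upwards [hpos, (tendsto_atTop_mono (fun m => Nat.le_add_left m n)
      tendsto_id).eventually hpos] with m hm hnm
    have hnm' : x (n + m) ℓ ≠ 0 := hnm.ne'
    rw [show n + 1 + m = n + m + 1 by ring]
    rw [Pi.div_apply, div_div_div_cancel_right₀ hnm']

end Critical

end MomentRecursion

end Recursion

end MarkedGW

namespace MarkedGW

open scoped ENNReal

/-! ### Cutting the tree at a generation. -/

section Combinatorics

/-- The labels read from the node `u` on. -/
def shift (u : List ℕ) (ω : List ℕ → ℕ × Bool) : List ℕ → ℕ × Bool := fun v => ω (u ++ v)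

theorem append_mem_nodes (ω : List ℕ → ℕ × Bool) (u v : List ℕ) :
    u ++ v ∈ (treeOf ω).nodes ↔ u ∈ (treeOf ω).nodes ∧ v ∈ (treeOf (shift u ω)).nodes := by
  induction v using List.reverseRecOn with
  | nil => simp [root_mem]
  | append_singleton v i ih =>
    rw [← List.append_assoc, treeOf_append, treeOf_append, ih, and_assoc, shift]

theorem append_mem_marked (ω : List ℕ → ℕ × Bool) (u v : List ℕ) :
    u ++ v ∈ (treeOf ω).marked ↔ u ∈ (treeOf ω).nodes ∧ v ∈ (treeOf (shift u ω)).marked := by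
  have h : ∀ ω u, u ∈ (treeOf ω).marked ↔ u ∈ (treeOf ω).nodes ∧ (ω u).2 = true :=
    fun _ _ => Iff.rfl
  rw [h, h, append_mem_nodes, and_assoc, shift]

theorem finite_marks (t : MarkedTree) (n : ℕ) : {u | u ∈ t.marked ∧ u.length < n}.Finite :=
  (finite_upTo t n).subset fun _ hu => ⟨t.marked_subset hu.1, hu.2.le⟩

/-- The nodes of generation `n`, as a finite set. -/
noncomputable def generation (n : ℕ) (t : MarkedTree) : Finset (List ℕ) :=
  (finite_generation t n).toFinset

theorem mem_generation {n : ℕ} {t : MarkedTree} {u : List ℕ} :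
    u ∈ generation n t ↔ u ∈ t.nodes ∧ u.length = n := by
  simp [generation]

theorem card_generation (n : ℕ) (t : MarkedTree) : (generation n t).card = Z n t :=
  (Set.ncard_eq_toFinset_card _ (finite_generation t n)).symm

/-- A marked word of length at least n splits uniquely into its prefix of length n, a node of
generation n, and a marked word of the subtree at that node. -/
theorem M_add (n m : ℕ) (ω : List ℕ → ℕ × Bool) : M (n + m) (treeOf ω) =
    M n (treeOf ω) + ∑ u ∈ generation n (treeOf ω), M m (treeOf (shift u ω)) := by
  have hM : ∀ n t, M n t = (finite_marks t n).toFinset.card := fun n t =>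
    Set.ncard_eq_toFinset_card _ (finite_marks t n)
  have hset : (finite_marks (treeOf ω) (n + m)).toFinset =
      (finite_marks (treeOf ω) n).toFinset ∪ (generation n (treeOf ω)).biUnion fun u =>
        (finite_marks (treeOf (shift u ω)) m).toFinset.image (u ++ ·) := by
    ext w
    simp only [Set.Finite.mem_toFinset, Set.mem_ofPred_eq, Finset.mem_union, Finset.mem_biUnion,
      mem_generation, Finset.mem_image]
    constructor
    · rintro ⟨hw, hl⟩
      by_cases h : w.length < n
      · exact Or.inl ⟨hw, h⟩
      · right
        rw [← List.take_append_drop n w, append_mem_marked] at hw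
        refine ⟨w.take n, ⟨hw.1, by simp; omega⟩, w.drop n, ⟨hw.2, by simp; omega⟩,
          List.take_append_drop n w⟩
    · rintro (⟨hw, hl⟩ | ⟨u, ⟨hu, hl⟩, v, ⟨hv, hvl⟩, rfl⟩)
      · exact ⟨hw, by omega⟩
      · exact ⟨(append_mem_marked ω u v).2 ⟨hu, hv⟩, by simp; omega⟩
  rw [hM, hset, Finset.card_union_of_disjoint, Finset.card_biUnion, hM]
  · congr 1
    refine Finset.sum_congr rfl fun u _ => ?_
    rw [Finset.card_image_of_injective _ fun a b h => List.append_cancel_left h, hM]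
  · intro u hu u' hu' hne
    refine Finset.disjoint_left.2 fun w hw hw' => ?_
    obtain ⟨v, _, rfl⟩ := Finset.mem_image.1 hw
    obtain ⟨v', _, h⟩ := Finset.mem_image.1 hw'
    have hl := (mem_generation.1 hu).2
    have hl' := (mem_generation.1 hu').2
    exact hne (List.append_inj h (by omega)).1.symm
  · rw [Finset.disjoint_left]
    intro w hw hw'
    simp only [Finset.mem_biUnion, mem_generation, Finset.mem_image] at hw'
    obtain ⟨u, ⟨_, hl⟩, v, _, rfl⟩ := hw'
    have := ((Set.Finite.mem_toFinset _).1 hw).2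
    simp at this
    omega

/-- The labels of the nodes of generation at least `n` are replaced by a default value. -/
def truncLabels (n : ℕ) (ω : List ℕ → ℕ × Bool) : List ℕ → ℕ × Bool :=
  fun v => if v.length < n then ω v else (0, false)

theorem restrict_treeOf_truncLabels (n : ℕ) (ω : List ℕ → ℕ × Bool) :
    restrict n (treeOf (truncLabels n ω)) = restrict n (treeOf ω) := by
  have hnode : ∀ u : List ℕ, u.length ≤ n →
      (u ∈ (treeOf (truncLabels n ω)).nodes ↔ u ∈ (treeOf ω).nodes) := by
    intro u hu
    refine forall_congr' fun v => forall_congr' fun i => forall_congr' fun hv => ?_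
    have := hv.length_le
    simp only [List.length_append, List.length_cons, List.length_nil] at this
    rw [truncLabels, if_pos (by omega)]
  ext u
  · exact and_congr_left fun hu => hnode u hu
  · refine and_congr_left fun hu => and_congr (hnode u hu.le) ?_
    rw [truncLabels, if_pos hu]

end Combinatorics

/-! ### Measurability with respect to generations and to sets of labels. -/

section Measurability

/-- The σ-field of generation n is the pullback of the full power set by `restrict n`, so every
function of the restriction is measurable. -/
theorem measurable_of_restrict {β : Type*} [MeasurableSpace β] {n : ℕ} {g : MarkedTree → β}
    (h : ∀ t, g (restrict n t) = g t) : Measurable[filtration n] g :=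
  fun s _ => ⟨g ⁻¹' s, trivial, by ext t; simp [h]⟩

theorem generation_restrict (n : ℕ) (t : MarkedTree) :
    generation n (restrict n t) = generation n t := by
  ext u
  simp only [mem_generation, restrict, Set.mem_ofPred_eq]
  constructor
  · rintro ⟨⟨h, _⟩, h'⟩; exact ⟨h, h'⟩
  · rintro ⟨h, h'⟩; exact ⟨⟨h, h'.le⟩, h'⟩

theorem Z_restrict (n : ℕ) (t : MarkedTree) : Z n (restrict n t) = Z n t := by
  rw [← card_generation, ← card_generation, generation_restrict]

theorem M_restrict (n : ℕ) (t : MarkedTree) : M n (restrict n t) = M n t := by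
  simp only [M, restrict, Set.mem_ofPred_eq, and_assoc, and_self]

theorem measurable_comp_M_Z {β : Type*} [MeasurableSpace β] (n : ℕ) (g : ℕ → ℕ → β) :
    Measurable[filtration n] fun t => g (M n t) (Z n t) :=
  measurable_of_restrict fun t => by rw [M_restrict, Z_restrict]

theorem measurable_indicator_of_filtration {n : ℕ} {Λ : Set MarkedTree}
    (hΛ : MeasurableSet[filtration n] Λ) :
    Measurable[filtration n] (Λ.indicator (1 : MarkedTree → ℝ≥0∞)) := by
  obtain ⟨A, -, rfl⟩ := hΛ
  refine measurable_of_restrict fun t => ?_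
  have h : restrict n t ∈ restrict n ⁻¹' A ↔ t ∈ restrict n ⁻¹' A := by
    simp only [Set.mem_preimage, restrict_restrict le_rfl]
  by_cases ht : t ∈ restrict n ⁻¹' A
  · rw [Set.indicator_of_mem ht, Set.indicator_of_mem (h.2 ht)]; rfl
  · rw [Set.indicator_of_notMem ht, Set.indicator_of_notMem (mt h.1 ht)]

theorem measurable_M (n : ℕ) : Measurable (M n) :=
  (measurable_comp_M_Z n fun s _ => s).mono (filtration.le n) le_rfl

/-- The σ-field generated by the labels of the nodes in `S`. -/
@[reducible] def labelSigma (S : Set (List ℕ)) : MeasurableSpace (List ℕ → ℕ × Bool) :=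
  ⨆ v ∈ S, MeasurableSpace.comap (fun ω => ω v) inferInstance

theorem labelSigma_le (S : Set (List ℕ)) : labelSigma S ≤ MeasurableSpace.pi :=
  iSup₂_le fun v _ => (measurable_pi_apply v).comap_le

theorem labelSigma_mono {S T : Set (List ℕ)} (h : S ⊆ T) : labelSigma S ≤ labelSigma T :=
  biSup_mono h

theorem measurable_eval_labelSigma {S : Set (List ℕ)} {v : List ℕ} (hv : v ∈ S) :
    Measurable[labelSigma S] fun ω : List ℕ → ℕ × Bool => ω v :=
  measurable_iff_comap_le.2 (le_iSup₂ (f := fun v (_ : v ∈ S) =>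
    MeasurableSpace.comap (fun ω : List ℕ → ℕ × Bool => ω v) inferInstance) v hv)

theorem measurable_shift (u : List ℕ) : Measurable[labelSigma {w | u <+: w}] (shift u) :=
  @measurable_pi_lambda _ _ _ (labelSigma {w | u <+: w}) _ _ fun v =>
    measurable_eval_labelSigma (List.prefix_append u v)

theorem measurable_truncLabels (n : ℕ) :
    Measurable[labelSigma {w | w.length < n}] (truncLabels n) := by
  refine @measurable_pi_lambda _ _ _ (labelSigma {w | w.length < n}) _ _ fun v => ?_
  by_cases hv : v.length < n
  · simp only [truncLabels, if_pos hv]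
    exact measurable_eval_labelSigma hv
  · simp only [truncLabels, if_neg hv]
    exact measurable_const

/-- An event of F_n does not change when the labels at depth at least n are replaced by the default.
-/
theorem measurable_treeOf_filtration (n : ℕ) :
    Measurable[labelSigma {w | w.length < n}, filtration n] treeOf := by
  rintro _ ⟨A, -, rfl⟩
  have h : treeOf ⁻¹' (restrict n ⁻¹' A) =
      truncLabels n ⁻¹' (treeOf ⁻¹' (restrict n ⁻¹' A)) := by
    ext ω
    simp only [Set.mem_preimage, restrict_treeOf_truncLabels]
  rw [h]
  exact measurable_truncLabels n (measurable_treeOf (filtration.le n _ ⟨A, trivial, rfl⟩))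

end Measurability

/-! ### Independence of subtrees and the branching formula. -/

section Branching

variable (p : PMF ℕ) (q : ℕ → unitInterval)

/-- The law of the independent labels. -/
noncomputable def labelLaw : Measure (List ℕ → ℕ × Bool) :=
  Measure.infinitePi fun _ : List ℕ => (reproMark p q).toMeasure

instance : IsProbabilityMeasure (labelLaw p q) := by unfold labelLaw; infer_instance

theorem law_eq_map : law p q = (labelLaw p q).map treeOf := rfl

theorem indep_labelSigma {S T : Set (List ℕ)} (h : Disjoint S T) :
    Indep (labelSigma S) (labelSigma T) (labelLaw p q) := by
  refine indep_iSup_of_disjoint (fun v => (measurable_pi_apply v).comap_le) ?_ h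
  exact (iIndepFun_infinitePi (P := fun _ : List ℕ => (reproMark p q).toMeasure)
    (X := fun _ x => x) fun _ => measurable_id)

/-- Shifting reindexes an i.i.d. family along the injection v ↦ u ++ v. -/
theorem map_shift_labelLaw (u : List ℕ) : (labelLaw p q).map (shift u) = labelLaw p q := by
  exact Measure.map_infinitePi_infinitePi_of_inj
    (P := fun _ => (reproMark p q).toMeasure) (List.append_right_injective u)

/-- The moment of order `j` of the number of marks in the first `n` generations. -/
noncomputable def markMoment (n j : ℕ) : ℝ≥0∞ := ∫⁻ t, (M n t : ℝ≥0∞) ^ j ∂(law p q)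

theorem markMoment_zero_right (n : ℕ) : markMoment p q n 0 = 1 := by simp [markMoment]

theorem lintegral_shift_pow (n j : ℕ) (u : List ℕ) :
    ∫⁻ ω, (M n (treeOf (shift u ω)) : ℝ≥0∞) ^ j ∂(labelLaw p q) = markMoment p q n j := by
  have hM : Measurable fun t => (M n t : ℝ≥0∞) ^ j :=
    (measurable_from_top (f := fun k : ℕ => (k : ℝ≥0∞) ^ j)).comp (measurable_M n)
  rw [markMoment, law_eq_map, lintegral_map hM measurable_treeOf]
  have h := lintegral_map (μ := labelLaw p q) (hM.comp measurable_treeOf)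
    ((measurable_shift u).mono (labelSigma_le _) le_rfl)
  rw [map_shift_labelLaw] at h
  exact h.symm

theorem measurable_M_shift (m : ℕ) (u : List ℕ) :
    Measurable[labelSigma {w | u <+: w}] fun ω => M m (treeOf (shift u ω)) :=
  ((measurable_M m).comp measurable_treeOf).comp (measurable_shift u)

theorem measurable_sum_M_shift (m : ℕ) (G : Finset (List ℕ)) :
    Measurable[labelSigma {w | ∃ u ∈ G, u <+: w}]
      fun ω => ∑ u ∈ G, M m (treeOf (shift u ω)) :=
  Finset.measurable_fun_sum G fun u hu =>
    (measurable_M_shift m u).mono (labelSigma_mono fun _ hw => ⟨u, hu, hw⟩) le_rfl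

/-- Distinct nodes of the same length are not prefixes of each other, so their subtrees read
disjoint sets of labels and are independent. Adding one node and expanding by the binomial formula
is the recursion of `convPow`. -/
theorem lintegral_sum_shift_pow {n : ℕ} (m : ℕ) {G : Finset (List ℕ)}
    (hG : ∀ u ∈ G, u.length = n) (j : ℕ) :
    ∫⁻ ω, ((∑ u ∈ G, M m (treeOf (shift u ω)) : ℕ) : ℝ≥0∞) ^ j ∂(labelLaw p q) =
      convPow (markMoment p q m) G.card j := by
  induction G using Finset.cons_induction generalizing j with
  | empty => by_cases hj : j = 0 <;> simp [hj, convPow_zero]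
  | cons u G hu ih =>
    have hd : Disjoint {w | u <+: w} {w | ∃ u ∈ G, u <+: w} := by
      rw [Set.disjoint_left]
      rintro w h1 ⟨u', hu', h2⟩
      have hl : u.length = u'.length := by
        rw [hG u (Finset.mem_cons_self _ _), hG u' (Finset.mem_cons_of_mem hu')]
      exact hu ((List.prefix_or_prefix_of_prefix h1 h2).elim
        (fun h => h.eq_of_length hl ▸ hu') (fun h => h.eq_of_length hl.symm ▸ hu'))
    have hX : ∀ k, Measurable[labelSigma {w | u <+: w}]
        fun ω => (M m (treeOf (shift u ω)) : ℝ≥0∞) ^ k := fun k =>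
      (measurable_from_top (f := fun i : ℕ => (i : ℝ≥0∞) ^ k)).comp (measurable_M_shift m u)
    have hY : ∀ k, Measurable[labelSigma {w | ∃ u ∈ G, u <+: w}]
        fun ω => ((∑ u ∈ G, M m (treeOf (shift u ω)) : ℕ) : ℝ≥0∞) ^ k := fun k =>
      (measurable_from_top (f := fun i : ℕ => (i : ℝ≥0∞) ^ k)).comp (measurable_sum_M_shift m G)
    have hXY : ∀ x : ℕ × ℕ, Measurable fun ω => (M m (treeOf (shift u ω)) : ℝ≥0∞) ^ x.1 *
        ((∑ u ∈ G, M m (treeOf (shift u ω)) : ℕ) : ℝ≥0∞) ^ x.2 := fun x =>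
      ((hX _).mono (labelSigma_le _) le_rfl).mul ((hY _).mono (labelSigma_le _) le_rfl)
    rw [Finset.card_cons, convPow_succ]
    simp only [Finset.sum_cons, Nat.cast_add, fun x y : ℝ≥0∞ => Commute.add_pow' (mul_comm x y) j,
      nsmul_eq_mul]
    rw [lintegral_finsetSum]
    · refine Finset.sum_congr rfl fun x _ => ?_
      rw [lintegral_const_mul _ (hXY x),
        lintegral_mul_eq_lintegral_mul_lintegral_of_independent_measurableSpace
          (labelSigma_le _) (labelSigma_le _) (indep_labelSigma p q hd) (hX _) (hY _),
        lintegral_shift_pow, ih fun u hu => hG u (Finset.mem_cons_of_mem hu), mul_assoc]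
    · exact fun x _ => (hXY x).const_mul _

theorem measurable_generation (n : ℕ) :
    Measurable[labelSigma {w | w.length < n}] fun ω => generation n (treeOf ω) :=
  (measurable_of_restrict (generation_restrict n) (β := Finset (List ℕ))).comp
    (measurable_treeOf_filtration n)

/-- The space is partitioned according to the value G of generation n, which ranges over a countable
type. On each piece the index set is fixed, and the factor `H` uses labels above generation n while
the sum uses labels at or below it. -/
theorem lintegral_mul_sum_shift_pow (n m j : ℕ) {H : (List ℕ → ℕ × Bool) → ℝ≥0∞}
    (hH : Measurable[labelSigma {w | w.length < n}] H) :
    ∫⁻ ω, H ω * ((∑ u ∈ generation n (treeOf ω), M m (treeOf (shift u ω)) : ℕ) : ℝ≥0∞) ^ j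
        ∂(labelLaw p q) =
      ∫⁻ ω, H ω * convPow (markMoment p q m) (Z n (treeOf ω)) j ∂(labelLaw p q) := by
  let s : Finset (List ℕ) → Set (List ℕ → ℕ × Bool) := fun G => {ω | generation n (treeOf ω) = G}
  have hs' : ∀ G, MeasurableSet[labelSigma {w | w.length < n}] (s G) := fun G =>
    measurable_generation n (MeasurableSet.singleton G)
  have hs : ∀ G, MeasurableSet (s G) := fun G => labelSigma_le _ _ (hs' G)
  have hd : Pairwise (Function.onFun Disjoint s) := fun G G' hne =>
    Set.disjoint_left.2 fun ω h h' => hne (h.symm.trans h')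
  have hU : ⋃ G, s G = Set.univ := Set.eq_univ_of_forall fun ω => Set.mem_iUnion.2 ⟨_, rfl⟩
  rw [← setLIntegral_univ, ← setLIntegral_univ (fun ω => H ω * convPow _ _ j), ← hU,
    lintegral_iUnion hs hd, lintegral_iUnion hs hd]
  refine tsum_congr fun G => ?_
  rcases (s G).eq_empty_or_nonempty with he | ⟨ω₀, hω₀⟩
  · rw [he]; simp
  have hG : ∀ u ∈ G, u.length = n := fun u hu => by
    have : generation n (treeOf ω₀) = G := hω₀
    rw [← this] at hu
    exact (mem_generation.1 hu).2
  have hdis : Disjoint {w : List ℕ | w.length < n} {w | ∃ u ∈ G, u <+: w} := by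
    rw [Set.disjoint_left]
    rintro w (h1 : w.length < n) ⟨u, hu, h2⟩
    have := h2.length_le
    rw [hG u hu] at this
    omega
  have hY : Measurable[labelSigma {w | ∃ u ∈ G, u <+: w}]
      fun ω => ((∑ u ∈ G, M m (treeOf (shift u ω)) : ℕ) : ℝ≥0∞) ^ j :=
    (measurable_from_top (f := fun i : ℕ => (i : ℝ≥0∞) ^ j)).comp (measurable_sum_M_shift m G)
  have hHs : Measurable[labelSigma {w | w.length < n}] ((s G).indicator H) :=
    hH.indicator (hs' G)
  calc ∫⁻ ω in s G, H ω *
        ((∑ u ∈ generation n (treeOf ω), M m (treeOf (shift u ω)) : ℕ) : ℝ≥0∞) ^ j ∂(labelLaw p q)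
      = ∫⁻ ω in s G, H ω * ((∑ u ∈ G, M m (treeOf (shift u ω)) : ℕ) : ℝ≥0∞) ^ j
          ∂(labelLaw p q) :=
        setLIntegral_congr_fun (hs G) fun ω hω => by
          have : generation n (treeOf ω) = G := hω
          simp only [this]
    _ = ∫⁻ ω, (s G).indicator H ω * ((∑ u ∈ G, M m (treeOf (shift u ω)) : ℕ) : ℝ≥0∞) ^ j
          ∂(labelLaw p q) := by
        rw [← lintegral_indicator (hs G)]
        simp only [Set.indicator_mul_left]
    _ = (∫⁻ ω, (s G).indicator H ω ∂(labelLaw p q)) * convPow (markMoment p q m) G.card j := by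
        rw [lintegral_mul_eq_lintegral_mul_lintegral_of_independent_measurableSpace
          (labelSigma_le _) (labelSigma_le _) (indep_labelSigma p q hdis) hHs hY,
          lintegral_sum_shift_pow p q m hG]
    _ = ∫⁻ ω in s G, H ω * convPow (markMoment p q m) G.card j ∂(labelLaw p q) := by
        rw [lintegral_indicator (hs G),
          lintegral_mul_const _ (hH.mono (labelSigma_le _) le_rfl)]
    _ = ∫⁻ ω in s G, H ω * convPow (markMoment p q m) (Z n (treeOf ω)) j ∂(labelLaw p q) :=
        setLIntegral_congr_fun (hs G) fun ω hω => by
          have : generation n (treeOf ω) = G := hω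
          simp only [← card_generation, this]

/-- The branching property, for the moments of the number of marks. -/
theorem setLIntegral_M_add_pow (n m j : ℕ) {Λ : Set MarkedTree}
    (hΛ : MeasurableSet[filtration n] Λ) :
    ∫⁻ t in Λ, (M (n + m) t : ℝ≥0∞) ^ j ∂(law p q) =
      ∑ i ∈ Finset.range (j + 1), (j.choose i : ℝ≥0∞) *
        ∑ r ∈ Finset.range (i + 1), redPow (markMoment p q m) r i *
          ∫⁻ t in Λ, (M n t : ℝ≥0∞) ^ (j - i) * ((Z n t).choose r : ℝ≥0∞) ∂(law p q) := by
  have hΛ' := filtration.le n _ hΛ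
  have hcast : Measurable fun k : ℕ => (k : ℝ≥0∞) ^ j := measurable_from_top
  have hind : ∀ (g : MarkedTree → ℝ≥0∞), Measurable g →
      ∫⁻ t in Λ, g t ∂(law p q) =
        ∫⁻ ω, (Λ.indicator 1 (treeOf ω)) * g (treeOf ω) ∂(labelLaw p q) := by
    intro g hg
    rw [← lintegral_indicator hΛ', law_eq_map, lintegral_map (hg.indicator hΛ') measurable_treeOf]
    refine lintegral_congr fun ω => ?_
    by_cases h : treeOf ω ∈ Λ <;> simp [h]
  have hmz : ∀ g : ℕ → ℕ → ℝ≥0∞, Measurable fun t => g (M n t) (Z n t) := fun g =>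
    (measurable_comp_M_Z n g).mono (filtration.le n) le_rfl
  have h1 : Measurable[labelSigma {w | w.length < n}]
      fun ω => Λ.indicator (1 : MarkedTree → ℝ≥0∞) (treeOf ω) :=
    (measurable_indicator_of_filtration hΛ).comp (measurable_treeOf_filtration n)
  have hH : ∀ i, Measurable[labelSigma {w | w.length < n}] fun ω =>
      Λ.indicator (1 : MarkedTree → ℝ≥0∞) (treeOf ω) * (M n (treeOf ω) : ℝ≥0∞) ^ i := fun i =>
    h1.mul ((measurable_comp_M_Z n fun s _ => (s : ℝ≥0∞) ^ i).comp
      (measurable_treeOf_filtration n))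
  -- The sum has a random index set; its measurability comes from writing it as a difference of two
  -- values of `M`.
  have hsum : ∀ i, Measurable fun ω => ((∑ u ∈ generation n (treeOf ω),
      M m (treeOf (shift u ω)) : ℕ) : ℝ≥0∞) ^ i := by
    intro i
    have : (fun ω => ((∑ u ∈ generation n (treeOf ω),
      M m (treeOf (shift u ω)) : ℕ) : ℝ≥0∞) ^ i) = fun ω =>
        ((M (n + m) (treeOf ω) - M n (treeOf ω) : ℕ) : ℝ≥0∞) ^ i := by
      funext ω
      rw [M_add, Nat.add_sub_cancel_left]
    rw [this]
    have hf : Measurable fun k : ℕ => (k : ℝ≥0∞) ^ i := measurable_from_top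
    have hd : Measurable fun ω => M (n + m) (treeOf ω) - M n (treeOf ω) :=
      ((measurable_M _).comp measurable_treeOf).sub ((measurable_M _).comp measurable_treeOf)
    exact hf.comp hd
  have hprod : ∀ i, Measurable fun ω => Λ.indicator 1 (treeOf ω) *
      (M n (treeOf ω) : ℝ≥0∞) ^ (j - i) * ((∑ u ∈ generation n (treeOf ω),
      M m (treeOf (shift u ω)) : ℕ) : ℝ≥0∞) ^ i := fun i =>
    ((hH _).mono (labelSigma_le _) le_rfl).mul (hsum _)
  rw [hind (fun t => (M (n + m) t : ℝ≥0∞) ^ j) (hcast.comp (measurable_M _))]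
  calc ∫⁻ ω, Λ.indicator 1 (treeOf ω) * (M (n + m) (treeOf ω) : ℝ≥0∞) ^ j ∂(labelLaw p q)
      = ∫⁻ ω, ∑ i ∈ Finset.range (j + 1), (j.choose i : ℝ≥0∞) *
          (Λ.indicator 1 (treeOf ω) * (M n (treeOf ω) : ℝ≥0∞) ^ (j - i) *
          ((∑ u ∈ generation n (treeOf ω), M m (treeOf (shift u ω)) : ℕ) : ℝ≥0∞) ^ i)
          ∂(labelLaw p q) := by
        refine lintegral_congr fun ω => ?_
        rw [M_add, Nat.cast_add, add_comm, add_pow, Finset.mul_sum]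
        exact Finset.sum_congr rfl fun i _ => by ring
    _ = ∑ i ∈ Finset.range (j + 1), (j.choose i : ℝ≥0∞) *
          ∫⁻ ω, Λ.indicator 1 (treeOf ω) * (M n (treeOf ω) : ℝ≥0∞) ^ (j - i) *
          convPow (markMoment p q m) (Z n (treeOf ω)) i ∂(labelLaw p q) := by
        rw [lintegral_finsetSum]
        · refine Finset.sum_congr rfl fun i _ => ?_
          rw [lintegral_const_mul _ (hprod i),
            lintegral_mul_sum_shift_pow p q n m i (hH _)]
        · exact fun i _ => (hprod i).const_mul _
    _ = _ := by
        refine Finset.sum_congr rfl fun i _ => congrArg _ ?_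
        have hz := fun r => hind _ (hmz fun s z => (s : ℝ≥0∞) ^ (j - i) * (z.choose r : ℝ≥0∞))
        have hm' : ∀ r, Measurable fun ω => Λ.indicator 1 (treeOf ω) *
            ((M n (treeOf ω) : ℝ≥0∞) ^ (j - i) * ((Z n (treeOf ω)).choose r : ℝ≥0∞)) := fun r =>
          (h1.mono (labelSigma_le _) le_rfl).mul
            ((hmz fun s z => (s : ℝ≥0∞) ^ (j - i) * (z.choose r : ℝ≥0∞)).comp measurable_treeOf)
        simp only [hz]
        simp only [← lintegral_const_mul _ (hm' _)]
        rw [← lintegral_finsetSum _ fun r _ => (hm' r).const_mul _]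
        refine lintegral_congr fun ω => ?_
        rw [convPow_eq_sum_redPow (markMoment_zero_right p q m), Finset.mul_sum]
        exact Finset.sum_congr rfl fun r _ => by ring

end Branching

end MarkedGW

namespace MarkedGW

open scoped ENNReal

/-! ### Passing from extended nonnegative to real moments. -/

section ENNRealLemmas

open Finset

theorem redPow_ne_top {a : ℕ → ℝ≥0∞} {i : ℕ} (h : ∀ t ≤ i, a t ≠ ∞) (r : ℕ) :
    redPow a r i ≠ ∞ := by
  induction r generalizing i with
  | zero => rw [redPow_zero]; split_ifs <;> simp
  | succ r ih =>
    rw [redPow_succ]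
    refine ENNReal.sum_ne_top.2 fun x hx => ?_
    have hx := mem_antidiagonal.1 hx
    refine ENNReal.mul_ne_top (ENNReal.mul_ne_top (by simp) ?_) (ih fun t ht => h t (by omega))
    split_ifs
    exacts [by simp, h _ (by omega)]

theorem toReal_redPow {a : ℕ → ℝ≥0∞} {i : ℕ} (h : ∀ t ≤ i, a t ≠ ∞) (r : ℕ) :
    (redPow a r i).toReal = redPow (fun t => (a t).toReal) r i := by
  induction r generalizing i with
  | zero => rw [redPow_zero, redPow_zero]; split_ifs <;> simp
  | succ r ih =>
    rw [redPow_succ, redPow_succ, ENNReal.toReal_sum]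
    · refine sum_congr rfl fun x hx => ?_
      have hx := mem_antidiagonal.1 hx
      rw [ENNReal.toReal_mul, ENNReal.toReal_mul, ih fun t ht => h t (by omega),
        apply_ite ENNReal.toReal]
      simp
    · intro x hx
      have hx := mem_antidiagonal.1 hx
      refine ENNReal.mul_ne_top (ENNReal.mul_ne_top (by simp) ?_)
        (redPow_ne_top (fun t ht => h t (by omega)) r)
      split_ifs
      exacts [by simp, h _ (by omega)]

variable {α : Type*} [MeasurableSpace α] {μ : Measure α} {g : α → ℕ}

theorem integral_natCast (hg : AEMeasurable g μ) :
    ∫ t, (g t : ℝ) ∂μ = (∫⁻ t, (g t : ℝ≥0∞) ∂μ).toReal := by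
  have hm : AEMeasurable (fun t => (g t : ℝ≥0∞)) μ :=
    (measurable_from_top (f := fun k : ℕ => (k : ℝ≥0∞))).comp_aemeasurable hg
  rw [← integral_toReal hm (by simp)]
  simp

theorem integrable_natCast (hg : AEMeasurable g μ) (h : ∫⁻ t, (g t : ℝ≥0∞) ∂μ ≠ ∞) :
    Integrable (fun t => (g t : ℝ)) μ := by
  simpa using integrable_toReal_of_lintegral_ne_top (measurable_from_top.comp_aemeasurable hg) h

end ENNRealLemmas

/-! ### The first generation as a function of the root label. -/

section FirstGeneration

theorem M_mono (t : MarkedTree) : Monotone fun n => M n t := fun _ m h =>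
  Set.ncard_le_ncard (fun _ hu => ⟨hu.1, hu.2.trans_le h⟩) (finite_marks t m)

theorem M_zero (t : MarkedTree) : M 0 t = 0 := by simp [M]

theorem Z_zero (t : MarkedTree) : Z 0 t = 1 := by
  have : {u | u ∈ t.nodes ∧ u.length = 0} = {[]} := by
    ext u
    simp only [Set.mem_ofPred_eq, List.length_eq_zero_iff, Set.mem_singleton_iff]
    exact ⟨fun h => h.2, fun h => ⟨h ▸ t.root_mem, h⟩⟩
  rw [Z, this, Set.ncard_singleton]

theorem Z_one_treeOf (ω : List ℕ → ℕ × Bool) : Z 1 (treeOf ω) = (ω []).1 := by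
  have : {u | u ∈ (treeOf ω).nodes ∧ u.length = 1} =
      ((Finset.range (ω []).1).image fun i => [i] : Finset (List ℕ)) := by
    ext u
    simp only [Set.mem_ofPred_eq, List.length_eq_one_iff, Finset.coe_image, Set.mem_image,
      Finset.mem_coe, Finset.mem_range]
    have h : ∀ i, [i] ∈ (treeOf ω).nodes ↔ i < (ω []).1 := fun i => by
      simpa [root_mem] using treeOf_append ω [] i
    constructor
    · rintro ⟨hu, i, rfl⟩
      exact ⟨i, (h i).1 hu, rfl⟩
    · rintro ⟨i, hi, rfl⟩
      exact ⟨(h i).2 hi, i, rfl⟩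
  rw [Z, this, Set.ncard_coe_finset, Finset.card_image_of_injective _ fun a b h => by simpa using h,
    Finset.card_range]

theorem M_one_treeOf (ω : List ℕ → ℕ × Bool) :
    M 1 (treeOf ω) = if (ω []).2 = true then 1 else 0 := by
  have hroot : [] ∈ (treeOf ω).marked ↔ (ω []).2 = true :=
    ⟨fun h => h.2, fun h => ⟨(treeOf ω).root_mem, h⟩⟩
  have : {u | u ∈ (treeOf ω).marked ∧ u.length < 1} = if (ω []).2 = true then {[]} else ∅ := by
    ext u
    simp only [Set.mem_ofPred_eq, Nat.lt_one_iff, List.length_eq_zero_iff]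
    constructor
    · rintro ⟨hu, rfl⟩
      simp [hroot.1 hu]
    · intro hu
      split_ifs at hu with h
      · obtain rfl : u = [] := hu
        exact ⟨hroot.2 h, rfl⟩
      · exact hu.elim
  rw [M, this]
  split_ifs <;> simp

variable (p : PMF ℕ) (q : ℕ → unitInterval)

theorem lintegral_root (g : ℕ → ℕ → ℝ≥0∞) : ∫⁻ t, g (M 1 t) (Z 1 t) ∂(law p q) =
    ∑' x : ℕ × Bool, g (if x.2 = true then 1 else 0) x.1 * reproMark p q x := by
  have hm : Measurable fun t => g (M 1 t) (Z 1 t) :=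
    (measurable_comp_M_Z 1 g).mono (filtration.le 1) le_rfl
  rw [law_eq_map, lintegral_map hm measurable_treeOf]
  simp only [Z_one_treeOf, M_one_treeOf]
  have h := lintegral_map (μ := labelLaw p q)
    (f := fun x : ℕ × Bool => g (if x.2 = true then 1 else 0) x.1)
    Measurable.of_discrete (measurable_pi_apply ([] : List ℕ))
  have h' : (labelLaw p q).map (fun ω => ω []) = (reproMark p q).toMeasure :=
    Measure.infinitePi_map_eval _ _
  rw [h', lintegral_countable'] at h
  rw [← h]
  refine tsum_congr fun x => ?_
  rw [PMF.toMeasure_apply_singleton _ _ (MeasurableSet.singleton x)]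

theorem reproMark_apply (x : ℕ × Bool) : reproMark p q x =
    p x.1 * ENNReal.ofReal (if x.2 = true then (q x.1 : ℝ) else 1 - (q x.1 : ℝ)) := rfl

theorem reproMark_add (k : ℕ) : reproMark p q (k, false) + reproMark p q (k, true) = p k := by
  rw [reproMark_apply, reproMark_apply, ← mul_add]
  simp only [Bool.false_eq_true, if_false, if_true]
  rw [← ENNReal.ofReal_add (by linarith [(q k).2.2]) (q k).2.1]
  simp

theorem lintegral_Z_one (g : ℕ → ℝ≥0∞) :
    ∫⁻ t, g (Z 1 t) ∂(law p q) = ∑' k, p k * g k := by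
  rw [lintegral_root p q fun _ z => g z, ENNReal.tsum_prod']
  refine tsum_congr fun k => ?_
  rw [tsum_bool, ← mul_add, reproMark_add, mul_comm]

/-- M_1 is 0 or 1, so all its positive powers coincide. -/
theorem markMoment_one {j : ℕ} (hj : 1 ≤ j) :
    markMoment p q 1 j = ∑' k, p k * ENNReal.ofReal (q k) := by
  rw [markMoment, lintegral_root p q fun s _ => (s : ℝ≥0∞) ^ j, ENNReal.tsum_prod']
  refine tsum_congr fun k => ?_
  rw [tsum_bool]
  simp [reproMark_apply, show j ≠ 0 by omega]

theorem M_one_le_one (t : MarkedTree) : M 1 t ≤ 1 := by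
  refine (Set.ncard_le_ncard (t := {[]}) ?_ (Set.finite_singleton _)).trans_eq
    (Set.ncard_singleton _)
  rintro u ⟨-, hu⟩
  simpa using hu

end FirstGeneration

/-! ### Finiteness of moments and the moment recursion. -/

section Moments

variable {p : PMF ℕ} (q : ℕ → unitInterval) {ℓ : ℕ}

/-- The mixed moments of the number of marks and of the size of the generation. -/
noncomputable def mixedMoment (p : PMF ℕ) (q : ℕ → unitInterval) (n a r : ℕ) : ℝ :=
  ∫ t, (M n t : ℝ) ^ a * ((Z n t).choose r : ℝ) ∂(law p q)

/-- The moments of the number of marks, as real numbers. -/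
noncomputable def realMoment (p : PMF ℕ) (q : ℕ → unitInterval) (n j : ℕ) : ℝ :=
  ∫ t, (M n t : ℝ) ^ j ∂(law p q)

theorem tsum_mul_choose_ne_top (hmom : Summable fun k : ℕ => (k : ℝ) ^ ℓ * (p k).toReal) {r : ℕ}
    (hr : r ≤ ℓ) : ∑' k, p k * ((k.choose r : ℕ) : ℝ≥0∞) ≠ ∞ := by
  have h1 : ∑' k, (p k + p k * (k : ℝ≥0∞) ^ ℓ) ≠ ∞ := by
    rw [ENNReal.tsum_add, p.tsum_coe]
    refine ENNReal.add_ne_top.2 ⟨by simp, ?_⟩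
    have h2 := hmom.tsum_ofReal_ne_top
    convert h2 using 3 with k
    rw [ENNReal.ofReal_mul (by positivity), ENNReal.ofReal_toReal (p.apply_ne_top k), mul_comm,
      ENNReal.ofReal_pow (by positivity), ENNReal.ofReal_natCast]
  refine ne_top_of_le_ne_top h1 (ENNReal.tsum_le_tsum fun k => ?_)
  -- The summand 1 covers k = 0, where `k ^ r ≤ k ^ ℓ` fails if r = 0 < ℓ.
  have h3 : k.choose r ≤ 1 + k ^ ℓ := by
    refine (Nat.choose_le_pow _ _).trans ?_
    rcases Nat.eq_zero_or_pos k with rfl | hk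
    · exact (pow_le_one₀ le_rfl zero_le_one).trans (Nat.le_add_right _ _)
    · exact (Nat.pow_le_pow_right hk hr).trans (Nat.le_add_left _ _)
  calc p k * ((k.choose r : ℕ) : ℝ≥0∞) ≤ p k * ((1 + k ^ ℓ : ℕ) : ℝ≥0∞) := by gcongr
    _ = _ := by push_cast; ring

/-- Induction by cutting at generation 1: since M_1 ≤ 1, the mixed moments at the root reduce to
binomial moments of the offspring law. -/
theorem markMoment_ne_top (hmom : Summable fun k : ℕ => (k : ℝ) ^ ℓ * (p k).toReal) (n : ℕ) {j : ℕ}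
    (hj : j ≤ ℓ) : markMoment p q n j ≠ ∞ := by
  induction n generalizing j with
  | zero => by_cases h : j = 0 <;> simp [markMoment, M_zero, h]
  | succ n ih =>
    have h := setLIntegral_M_add_pow p q 1 n j MeasurableSet.univ
    rw [setLIntegral_univ, add_comm] at h
    rw [markMoment, h]
    refine ENNReal.sum_ne_top.2 fun i hi => ENNReal.mul_ne_top (by simp)
      (ENNReal.sum_ne_top.2 fun r hr => ENNReal.mul_ne_top ?_ ?_)
    · have hi := Finset.mem_range.1 hi
      exact redPow_ne_top (fun t ht => ih (by omega)) r
    · have hi := Finset.mem_range.1 hi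
      have hr := Finset.mem_range.1 hr
      rw [setLIntegral_univ]
      refine ne_top_of_le_ne_top (tsum_mul_choose_ne_top hmom (show r ≤ ℓ by omega)) ?_
      rw [← lintegral_Z_one p q fun k => ((k.choose r : ℕ) : ℝ≥0∞)]
      refine lintegral_mono fun t => mul_le_of_le_one_left' (pow_le_one₀ (by simp) ?_)
      exact_mod_cast M_one_le_one t

theorem measurable_natCast_comp (n : ℕ) (g : ℕ → ℕ → ℕ) : Measurable fun t => g (M n t) (Z n t) :=
  (measurable_comp_M_Z n g).mono (filtration.le n) le_rfl

theorem realMoment_eq_toReal (n j : ℕ) : realMoment p q n j = (markMoment p q n j).toReal := by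
  have h := integral_natCast (μ := law p q)
    (measurable_natCast_comp n fun s _ => s ^ j).aemeasurable
  push_cast at h
  exact h

theorem integrable_M_pow (hmom : Summable fun k : ℕ => (k : ℝ) ^ ℓ * (p k).toReal) (n : ℕ) {j : ℕ}
    (hj : j ≤ ℓ) : Integrable (fun t => (M n t : ℝ) ^ j) (law p q) := by
  have h := integrable_natCast (μ := law p q)
    (measurable_natCast_comp n fun s _ => s ^ j).aemeasurable
  push_cast at h
  exact h (markMoment_ne_top q hmom n hj)

theorem tsum_mul_mark_pos (hq : ∃ k : ℕ, 0 < (p k).toReal * (q k : ℝ)) :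
    0 < ∑' k, p k * ENNReal.ofReal (q k) := by
  obtain ⟨k, hk⟩ := hq
  refine lt_of_lt_of_le ?_ (ENNReal.le_tsum k)
  have h1 : (p k).toReal ≠ 0 := fun h => by simp [h] at hk
  have h2 : 0 < (q k : ℝ) := lt_of_le_of_ne (q k).2.1 fun h => by simp [← h] at hk
  refine ENNReal.mul_pos (fun h => h1 (by simp [h])) ?_
  simpa using h2

theorem realMoment_one_pos (hmom : Summable fun k : ℕ => (k : ℝ) ^ ℓ * (p k).toReal)
    (hq : ∃ k : ℕ, 0 < (p k).toReal * (q k : ℝ)) {j : ℕ} (hj : j ≤ ℓ) : 0 < realMoment p q 1 j := by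
  rw [realMoment_eq_toReal]
  refine ENNReal.toReal_pos ?_ (markMoment_ne_top q hmom 1 hj)
  rcases Nat.eq_zero_or_pos j with rfl | h
  · simp [markMoment_zero_right]
  · rw [markMoment_one p q h]
    exact (tsum_mul_mark_pos q hq).ne'

theorem realMoment_nonneg (n j : ℕ) : 0 ≤ realMoment p q n j :=
  integral_nonneg fun _ => by positivity

/-- The branching formula is read backwards: E[M_{n+1}^j] is finite and is a sum of nonnegative
terms, so each mixed moment with a nonzero coefficient is finite. For r ≥ 1 the coefficient is
positive because all moments of M_1 are; r = 0 is handled separately, as its coefficient may vanish.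
-/
theorem lintegral_mixed_ne_top (hmom : Summable fun k : ℕ => (k : ℝ) ^ ℓ * (p k).toReal)
    (hq : ∃ k : ℕ, 0 < (p k).toReal * (q k : ℝ)) (n : ℕ) {i j r : ℕ} (hr : r ≤ i) (hi : i ≤ j)
    (hj : j ≤ ℓ) :
    ∫⁻ t, (M n t : ℝ≥0∞) ^ (j - i) * ((Z n t).choose r : ℝ≥0∞) ∂(law p q) ≠ ∞ := by
  rcases Nat.eq_zero_or_pos r with rfl | hr0
  · simpa [markMoment] using markMoment_ne_top q hmom n (show j - i ≤ ℓ by omega)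
  have h := setLIntegral_M_add_pow p q n 1 j MeasurableSet.univ
  rw [setLIntegral_univ] at h
  have hfin : (∫⁻ t, (M (n + 1) t : ℝ≥0∞) ^ j ∂(law p q)) ≠ ∞ := markMoment_ne_top q hmom (n + 1) hj
  rw [h, ENNReal.sum_ne_top] at hfin
  have h1 := hfin i (Finset.mem_range.2 (by omega))
  have h2 : ((j.choose i : ℕ) : ℝ≥0∞) ≠ 0 := by exact_mod_cast (Nat.choose_pos hi).ne'
  have h3 := ENNReal.sum_ne_top.1 (ENNReal.lt_top_of_mul_ne_top_right h1 h2).ne r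
    (Finset.mem_range.2 (by omega))
  have h4 : redPow (markMoment p q 1) r i ≠ 0 := fun h0 => by
    have h5 := toReal_redPow (a := markMoment p q 1) (i := i)
      (fun t ht => markMoment_ne_top q hmom 1 (by omega)) r
    rw [h0, ENNReal.toReal_zero] at h5
    refine (redPow_pos (fun t => ENNReal.toReal_nonneg) (fun t h1 h2 => ?_) hr0 hr).ne h5
    rw [← realMoment_eq_toReal]
    exact realMoment_one_pos q hmom hq (by omega)
  simpa using (ENNReal.lt_top_of_mul_ne_top_right h3 h4).ne

theorem integrable_mixed (hmom : Summable fun k : ℕ => (k : ℝ) ^ ℓ * (p k).toReal)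
    (hq : ∃ k : ℕ, 0 < (p k).toReal * (q k : ℝ)) (n : ℕ) {i j r : ℕ} (hr : r ≤ i) (hi : i ≤ j)
    (hj : j ≤ ℓ) :
    Integrable (fun t => (M n t : ℝ) ^ (j - i) * ((Z n t).choose r : ℝ)) (law p q) := by
  have h := integrable_natCast (μ := law p q)
    (measurable_natCast_comp n fun s z => s ^ (j - i) * z.choose r).aemeasurable
  push_cast at h
  exact h (lintegral_mixed_ne_top q hmom hq n hr hi hj)

theorem setIntegral_M_add_pow (hmom : Summable fun k : ℕ => (k : ℝ) ^ ℓ * (p k).toReal)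
    (hq : ∃ k : ℕ, 0 < (p k).toReal * (q k : ℝ)) (n m : ℕ) {j : ℕ} (hj : j ≤ ℓ)
    {Λ : Set MarkedTree} (hΛ : MeasurableSet[filtration n] Λ) :
    ∫ t in Λ, (M (n + m) t : ℝ) ^ j ∂(law p q) =
      ∑ i ∈ Finset.range (j + 1), (j.choose i : ℝ) *
        ∑ r ∈ Finset.range (i + 1), redPow (realMoment p q m) r i *
          ∫ t in Λ, (M n t : ℝ) ^ (j - i) * ((Z n t).choose r : ℝ) ∂(law p q) := by
  have h1 := integral_natCast (μ := (law p q).restrict Λ)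
    (measurable_natCast_comp (n + m) fun s _ => s ^ j).aemeasurable
  push_cast at h1
  have h2 := fun i r => integral_natCast (μ := (law p q).restrict Λ)
    (measurable_natCast_comp n fun s z => s ^ (j - i) * z.choose r).aemeasurable
  push_cast at h2
  have hfin : ∀ i ∈ Finset.range (j + 1), ∀ r ∈ Finset.range (i + 1),
      redPow (markMoment p q m) r i *
        ∫⁻ t in Λ, (M n t : ℝ≥0∞) ^ (j - i) * ((Z n t).choose r : ℝ≥0∞) ∂(law p q) ≠ ∞ := by
    intro i hi r hr
    have hi := Finset.mem_range.1 hi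
    have hr := Finset.mem_range.1 hr
    exact ENNReal.mul_ne_top (redPow_ne_top (fun t ht => markMoment_ne_top q hmom m (by omega)) r)
      (ne_top_of_le_ne_top (lintegral_mixed_ne_top q hmom hq n (by omega) (by omega) hj)
        (setLIntegral_le_lintegral _ _))
  rw [h1, setLIntegral_M_add_pow p q n m j hΛ, ENNReal.toReal_sum fun i hi =>
    ENNReal.mul_ne_top (by simp) (ENNReal.sum_ne_top.2 (hfin i hi))]
  refine Finset.sum_congr rfl fun i hi => ?_
  rw [ENNReal.toReal_mul, ENNReal.toReal_natCast, ENNReal.toReal_sum (hfin i hi)]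
  refine congrArg _ (Finset.sum_congr rfl fun r _ => ?_)
  have hi := Finset.mem_range.1 hi
  rw [ENNReal.toReal_mul, toReal_redPow (fun t ht => markMoment_ne_top q hmom m (by omega)), h2]
  simp only [← realMoment_eq_toReal]

theorem mixedMoment_one_eq_tsum (r : ℕ) :
    mixedMoment p q 1 0 r = ∑' k, (p k).toReal * (k.choose r : ℝ) := by
  have h := integral_natCast (μ := law p q)
    (measurable_natCast_comp 1 fun _ z => z.choose r).aemeasurable
  simp only [mixedMoment, pow_zero, one_mul]
  rw [h, lintegral_Z_one p q fun k => ((k.choose r : ℕ) : ℝ≥0∞),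
    ENNReal.tsum_toReal_eq fun k => ENNReal.mul_ne_top (p.apply_ne_top k) (by simp)]
  simp

theorem mixedMoment_one_one : mixedMoment p q 1 0 1 = mean p := by
  rw [mixedMoment_one_eq_tsum, mean]
  exact tsum_congr fun k => by rw [Nat.choose_one_right, mul_comm]

theorem realMoment_one_one : realMoment p q 1 1 = ∑' k : ℕ, (p k).toReal * (q k : ℝ) := by
  rw [realMoment_eq_toReal, markMoment_one p q le_rfl,
    ENNReal.tsum_toReal_eq fun k => ENNReal.mul_ne_top (p.apply_ne_top k) (by simp)]
  exact tsum_congr fun k => by rw [ENNReal.toReal_mul, ENNReal.toReal_ofReal (q k).2.1]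

theorem summable_mul_choose (hmom : Summable fun k : ℕ => (k : ℝ) ^ ℓ * (p k).toReal) {r : ℕ}
    (hr : r ≤ ℓ) : Summable fun k => (p k).toReal * (k.choose r : ℝ) := by
  simpa using ENNReal.summable_toReal (tsum_mul_choose_ne_top hmom hr)

/-- This supplies `weight_zero_two`, the positivity behind the critical lower bound and the
positivity of ω_j. -/
theorem exists_two_le_ne_zero (hp : (p 0).toReal + (p 1).toReal < 1) : ∃ k, 2 ≤ k ∧ p k ≠ 0 := by
  by_contra! h
  have h1 := p.tsum_coe
  rw [tsum_eq_sum (s := {0, 1}) fun k hk => h k (by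
    simp only [Finset.mem_insert, Finset.mem_singleton] at hk; omega),
    Finset.sum_pair (by norm_num)] at h1
  rw [← ENNReal.toReal_add (p.apply_ne_top 0) (p.apply_ne_top 1), h1] at hp
  simp at hp

theorem momentRecursion (hp : (p 0).toReal + (p 1).toReal < 1)
    (hmom : Summable fun k : ℕ => (k : ℝ) ^ ℓ * (p k).toReal)
    (hq : ∃ k : ℕ, 0 < (p k).toReal * (q k : ℝ)) :
    MomentRecursion ℓ (mixedMoment p q 1) (realMoment p q) where
  weight_nonneg a r := integral_nonneg fun _ => by positivity
  weight_zero_two hℓ := by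
    obtain ⟨k, hk, hpk⟩ := exists_two_le_ne_zero hp
    rw [mixedMoment_one_eq_tsum]
    refine (summable_mul_choose hmom hℓ).tsum_pos (fun k => by positivity) k ?_
    have := Nat.choose_pos hk
    have := ENNReal.toReal_pos hpk (p.apply_ne_top k)
    positivity
  nonneg := realMoment_nonneg q
  zero_right n := by simp [realMoment]
  zero_left j hj := by simp [realMoment, M_zero, show j ≠ 0 by omega]
  mono n m h j hj := integral_mono (integrable_M_pow q hmom n hj) (integrable_M_pow q hmom m hj)
    fun t => pow_le_pow_left₀ (by positivity) (Nat.cast_le.2 (M_mono t h)) j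
  pos j _ hj := realMoment_one_pos q hmom hq hj
  step n j hj := by
    have h := setIntegral_M_add_pow q hmom hq 1 n hj MeasurableSet.univ
    simp only [setIntegral_univ] at h
    rw [add_comm 1 n] at h
    exact h

end Moments

end MarkedGW

namespace MarkedGW

open scoped ENNReal

variable {p : PMF ℕ} {q : ℕ → unitInterval} {ℓ : ℕ}

/-! ### From limits of coefficients to the penalization martingale. -/

section Penalization

/-- The martingale property follows from the convergence, by uniqueness of limits. -/
theorem martingale_of_tendsto {P : Measure MarkedTree} [IsProbabilityMeasure P] {x : ℕ → ℝ}
    {B : ℕ → MarkedTree → ℝ} (hB : ∀ n, StronglyMeasurable[filtration n] (B n))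
    (hint : ∀ n, Integrable (B n) P)
    (hlim : ∀ (n : ℕ) (Λ : Set MarkedTree), MeasurableSet[filtration n] Λ →
      Tendsto (fun r : ℕ => (∫ t in Λ, (M (n + r) t : ℝ) ^ ℓ ∂P) / x (n + r)) atTop
        (𝓝 (∫ t in Λ, B n t ∂P))) : Martingale B filtration P := by
  refine ⟨hB, fun i j hij => (ae_eq_condExp_of_forall_setIntegral_eq (filtration.le i) (hint j)
    (fun s _ _ => (hint i).integrableOn) (fun s hs _ => ?_)
    (hB i).aestronglyMeasurable).symm⟩
  obtain ⟨k, rfl⟩ := Nat.exists_eq_add_of_le hij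
  -- For Λ in F_i, the ratios seen from times i and i + k form the same sequence up to a shift, so
  -- their limits agree.
  have h1 := (tendsto_add_atTop_iff_nat k).2 (hlim i s hs)
  have h2 := hlim (i + k) s (filtration.mono hij s hs)
  refine tendsto_nhds_unique h1 (h2.congr fun r => ?_)
  rw [show i + k + r = i + (r + k) by ring]

/-- The limiting density associated with the limits `L i r` of the normalized coefficients. -/
noncomputable def density (ℓ : ℕ) (L : ℕ → ℕ → ℝ) (s z : ℕ) : ℝ :=
  ∑ i ∈ Finset.range (ℓ + 1), (ℓ.choose i : ℝ) *
    ∑ r ∈ Finset.range (i + 1), L i r * ((s : ℝ) ^ (ℓ - i) * (z.choose r : ℝ))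

/-- The number of terms does not depend on the time r, so the limit is taken term by term;
nonnegativity of the density is inherited from that of the coefficients. -/
theorem isPenalizationMartingale_density (hℓ : 1 ≤ ℓ) (hp : (p 0).toReal + (p 1).toReal < 1)
    (hmom : Summable fun k : ℕ => (k : ℝ) ^ ℓ * (p k).toReal)
    (hq : ∃ k : ℕ, 0 < (p k).toReal * (q k : ℝ)) {L : ℕ → ℕ → ℕ → ℝ}
    (hL : ∀ n i r, i ≤ ℓ → r ≤ i → Tendsto
      (fun m => redPow (realMoment p q m) r i / realMoment p q (n + m) ℓ) atTop (𝓝 (L n i r))) :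
    IsPenalizationMartingale (law p q) ℓ fun n t => density ℓ (L n) (M n t) (Z n t) := by
  have hx := momentRecursion q hp hmom hq
  have hint : ∀ n, ∀ i ∈ Finset.range (ℓ + 1), ∀ r ∈ Finset.range (i + 1),
      Integrable (fun t => L n i r * ((M n t : ℝ) ^ (ℓ - i) * ((Z n t).choose r : ℝ)))
        (law p q) := fun n i hi r hr => by
    have hi := Finset.mem_range.1 hi
    have hr := Finset.mem_range.1 hr
    exact (integrable_mixed q hmom hq n (by omega) (by omega) le_rfl).const_mul _
  have hintB : ∀ n, Integrable (fun t => density ℓ (L n) (M n t) (Z n t)) (law p q) := fun n =>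
    integrable_finsetSum _ fun i hi => (integrable_finsetSum _ fun r hr =>
      hint n i hi r hr).const_mul _
  have hlim : ∀ (n : ℕ) (Λ : Set MarkedTree), MeasurableSet[filtration n] Λ →
      Tendsto (fun r : ℕ => (∫ t in Λ, (M (n + r) t : ℝ) ^ ℓ ∂(law p q)) /
        realMoment p q (n + r) ℓ) atTop
        (𝓝 (∫ t in Λ, density ℓ (L n) (M n t) (Z n t) ∂(law p q))) := by
    intro n Λ hΛ
    have hsum : ∫ t in Λ, density ℓ (L n) (M n t) (Z n t) ∂(law p q) =
        ∑ i ∈ Finset.range (ℓ + 1), (ℓ.choose i : ℝ) * ∑ r ∈ Finset.range (i + 1), L n i r *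
          ∫ t in Λ, (M n t : ℝ) ^ (ℓ - i) * ((Z n t).choose r : ℝ) ∂(law p q) := by
      simp only [density]
      rw [integral_finsetSum _ fun i hi => ((integrable_finsetSum _ fun r hr =>
        hint n i hi r hr).const_mul _).integrableOn]
      refine Finset.sum_congr rfl fun i hi => ?_
      rw [integral_const_mul, integral_finsetSum _ fun r hr => (hint n i hi r hr).integrableOn]
      simp only [integral_const_mul]
    rw [hsum]
    simp only [setIntegral_M_add_pow q hmom hq n _ le_rfl hΛ, Finset.sum_div]
    refine tendsto_finsetSum _ fun i hi => ?_
    simp only [mul_div_assoc, Finset.sum_div]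
    refine (tendsto_finsetSum _ fun r hr => ?_).const_mul _
    have hi := Finset.mem_range.1 hi
    have hr := Finset.mem_range.1 hr
    exact ((hL n i r (by omega) (by omega)).mul_const _).congr fun m => by ring
  have hL0 : ∀ n i r, i ≤ ℓ → r ≤ i → 0 ≤ L n i r := fun n i r hi hr =>
    ge_of_tendsto' (hL n i r hi hr) fun m =>
      div_nonneg (redPow_nonneg (hx.nonneg m) _ _) (hx.nonneg _ _)
  refine ⟨martingale_of_tendsto (ℓ := ℓ) (x := fun m => realMoment p q m ℓ) (fun n => (measurable_comp_M_Z n _).stronglyMeasurable)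
    hintB hlim, fun n t => ?_, fun t => ?_, hlim⟩
  · refine Finset.sum_nonneg fun i hi => mul_nonneg (by positivity)
      (Finset.sum_nonneg fun r hr => mul_nonneg ?_ (by positivity))
    have hi := Finset.mem_range.1 hi
    have hr := Finset.mem_range.1 hr
    exact hL0 n i r (by omega) (by omega)
  -- At time 0, where M_0 = 0 and Z_0 = 1, only the terms i = ℓ with r ≤ 1 survive; their
  -- coefficients are identified by uniqueness of limits.
  · have h1 : L 0 ℓ 1 = 1 := by
      refine tendsto_nhds_unique (hL 0 ℓ 1 le_rfl hℓ) (tendsto_const_nhds.congr' ?_)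
      filter_upwards [eventually_ge_atTop 1] with m hm
      rw [redPow_one _ hℓ, zero_add, div_self (hx.pos_of_pos hm hℓ le_rfl).ne']
    have h0 : L 0 ℓ 0 = 0 := by
      refine tendsto_nhds_unique (hL 0 ℓ 0 le_rfl (by omega)) (tendsto_const_nhds.congr fun m => ?_)
      rw [redPow_zero_of_pos _ hℓ, zero_div]
    rw [density, Finset.sum_range_succ, Finset.sum_eq_zero fun i hi => ?_,
      sum_range_succ_eq_Icc hℓ (by simp [h0]), Finset.sum_eq_zero fun r hr => ?_]
    · simp [h1, M_zero, Z_zero]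
    · rw [Z_zero, Nat.choose_eq_zero_of_lt (by have := (Finset.mem_Icc.1 hr).1; omega)]
      simp
    · have := Finset.mem_range.1 hi
      simp [M_zero, show ℓ - i ≠ 0 by omega]

theorem density_of_top (g : ℕ → ℝ) (s z : ℕ) :
    density ℓ (fun i r => if i = ℓ then g r else 0) s z =
      ∑ r ∈ Finset.range (ℓ + 1), g r * (z.choose r : ℝ) := by
  rw [density, Finset.sum_range_succ, Finset.sum_eq_zero fun i hi => ?_]
  · simp
  · have := Finset.mem_range.1 hi
    simp [show i ≠ ℓ by omega]

end Penalization

/-! ### The total number of marks when its moments are bounded. -/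

section Subcritical

theorem totalMarks_eq_of_finite {t : MarkedTree} (h : t.marked.Finite) :
    ∃ N, ∀ n ≥ N, M n t = totalMarks t := by
  obtain ⟨N, hN⟩ := (h.image List.length).bddAbove
  refine ⟨N + 1, fun n hn => ?_⟩
  have : {u | u ∈ t.marked ∧ u.length < n} = t.marked := by
    ext u
    refine ⟨fun hu => hu.1, fun hu => ⟨hu, ?_⟩⟩
    have := hN (Set.mem_image_of_mem _ hu)
    omega
  rw [M, totalMarks, this]

theorem marked_finite_of_M_le {t : MarkedTree} {K : ℕ} (h : ∀ n, M n t ≤ K) :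
    t.marked.Finite := by
  by_contra hinf
  obtain ⟨s, hs, hcard⟩ := Set.Infinite.exists_subset_card_eq hinf (K + 1)
  obtain ⟨N, hN⟩ := (s.finite_toSet.image List.length).bddAbove
  have h1 : s.card ≤ M (N + 1) t := by
    rw [M, ← Set.ncard_coe_finset]
    refine Set.ncard_le_ncard (fun u hu => ⟨hs hu, ?_⟩) (finite_marks t (N + 1))
    have := hN (Set.mem_image_of_mem _ hu)
    omega
  have := h (N + 1)
  omega

/-- By monotone convergence the supremum of the M_n has finite mean, hence is finite almost surely.
-/
theorem ae_marked_finite (hmom : Summable fun k : ℕ => (k : ℝ) ^ ℓ * (p k).toReal) (hℓ : 1 ≤ ℓ)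
    {b : ℝ} (hb : Tendsto (fun n => realMoment p q n 1) atTop (𝓝 b)) :
    ∀ᵐ t ∂(law p q), t.marked.Finite := by
  have hM : ∀ n, Measurable fun t => (M n t : ℝ≥0∞) := fun n =>
    (measurable_from_top (f := fun k : ℕ => (k : ℝ≥0∞))).comp (measurable_M n)
  have hsup : ∫⁻ t, ⨆ n, (M n t : ℝ≥0∞) ∂(law p q) ≠ ∞ := by
    rw [lintegral_iSup hM fun n m h t => Nat.cast_le.2 (M_mono t h)]
    obtain ⟨C, hC⟩ := hb.bddAbove_range
    refine ne_top_of_le_ne_top (ENNReal.ofReal_ne_top (r := C)) (iSup_le fun n => ?_)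
    have h1 := hC ⟨n, rfl⟩
    simp only [realMoment_eq_toReal] at h1
    have h2 := (ENNReal.le_ofReal_iff_toReal_le (markMoment_ne_top q hmom n hℓ)
      (ENNReal.toReal_nonneg.trans h1)).2 h1
    simpa [markMoment] using h2
  filter_upwards [ae_lt_top (Measurable.iSup hM) hsup] with t ht
  obtain ⟨K, hK⟩ := ENNReal.exists_nat_gt ht.ne
  exact marked_finite_of_M_le (K := K) fun n =>
    Nat.cast_le.1 ((le_iSup (fun n => (M n t : ℝ≥0∞)) n).trans hK.le)

theorem integrable_totalMarks_pow (hmom : Summable fun k : ℕ => (k : ℝ) ^ ℓ * (p k).toReal)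
    (hfin : ∀ᵐ t ∂(law p q), t.marked.Finite) {j : ℕ} (hj : j ≤ ℓ) {b : ℝ}
    (hb : Tendsto (fun n => realMoment p q n j) atTop (𝓝 b)) :
    Integrable (fun t => (totalMarks t : ℝ) ^ j) (law p q) ∧ xi p q j = b := by
  have hev : ∀ᵐ t ∂(law p q), ∀ᶠ n in atTop, M n t = totalMarks t := by
    filter_upwards [hfin] with t ht
    obtain ⟨N, hN⟩ := totalMarks_eq_of_finite ht
    exact eventually_atTop.2 ⟨N, hN⟩
  have hlint : Tendsto (fun n => markMoment p q n j) atTop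
      (𝓝 (∫⁻ t, (totalMarks t : ℝ≥0∞) ^ j ∂(law p q))) := by
    refine lintegral_tendsto_of_tendsto_of_monotone (fun n => ?_) ?_ ?_
    · exact ((measurable_from_top (f := fun k : ℕ => (k : ℝ≥0∞) ^ j)).comp
        (measurable_M n)).aemeasurable
    · exact Eventually.of_forall fun t n m h => pow_le_pow_left' (Nat.cast_le.2 (M_mono t h)) j
    · filter_upwards [hev] with t ht
      exact tendsto_const_nhds.congr' (ht.mono fun n hn => by simp only [hn])
  -- `totalMarks` is the limit of the M_n only where the marks are finite in number, since `ncard`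
  -- of an infinite set is 0.
  have hmeas : AEMeasurable totalMarks (law p q) :=
    aemeasurable_of_tendsto_metrizable_ae atTop (fun n => (measurable_M n).aemeasurable) (by
      filter_upwards [hev] with t ht
      exact tendsto_const_nhds.congr' (ht.mono fun n hn => by simp only [hn]))
  have hmeas' : AEMeasurable (fun t => totalMarks t ^ j) (law p q) := hmeas.pow_const j
  have hof : Tendsto (fun n => markMoment p q n j) atTop (𝓝 (ENNReal.ofReal b)) := by
    refine (ENNReal.tendsto_ofReal hb).congr fun n => ?_
    rw [realMoment_eq_toReal, ENNReal.ofReal_toReal (markMoment_ne_top q hmom n hj)]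
  have heq := tendsto_nhds_unique hlint hof
  have hb0 : 0 ≤ b := ge_of_tendsto' hb fun n => realMoment_nonneg q n j
  constructor
  · have h := integrable_natCast hmeas'
    push_cast at h
    exact h (heq ▸ ENNReal.ofReal_ne_top)
  · have h := integral_natCast hmeas'
    push_cast at h
    rw [xi, h, heq, ENNReal.toReal_ofReal hb0]

theorem f_eq_density (hξ : xi p q 0 = 1) (s z : ℕ) : f p q ℓ s z =
    density ℓ (fun i r => redPow (xi p q) r i / xi p q ℓ) s z := by
  rw [f, density, Finset.mul_sum]
  refine Finset.sum_congr rfl fun i _ => ?_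
  rw [multiSum_eq_convPow, convPow_eq_sum_redPow hξ, Finset.mul_sum, Finset.mul_sum,
    Finset.mul_sum]
  exact Finset.sum_congr rfl fun r _ => by ring

end Subcritical

/-! ### The constants ω_j and the polynomial P_ℓ. -/

section Supercritical

theorem omega_zero : omega p q 0 = 1 := by rw [omega]

theorem omega_one : omega p q 1 = realMoment p q 1 1 / (mixedMoment p q 1 0 1 - 1) := by
  rw [omega, realMoment_one_one, mixedMoment_one_one]

theorem omega_of_two_le (hmom : Summable fun k : ℕ => (k : ℝ) ^ ℓ * (p k).toReal) {j : ℕ}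
    (hj2 : 2 ≤ j) (hj : j ≤ ℓ) : omega p q j =
      (∑ r ∈ Finset.Icc 2 j, redPow (omega p q) r j * mixedMoment p q 1 0 r) /
        (mixedMoment p q 1 0 1 ^ j - mixedMoment p q 1 0 1) := by
  obtain ⟨m, rfl⟩ := Nat.exists_eq_add_of_le' hj2
  rw [omega, mixedMoment_one_one]
  congr 1
  -- Cutting ω at m + 2 encodes the restriction t_i < j; in the binomial expansion it deletes
  -- exactly the term r = 1 and leaves those with r ≥ 2 unchanged.
  set a : ℕ → ℝ := fun t => if t < m + 2 then omega p q t else 0 with ha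
  have h1 : ∀ k : ℕ, ∑ t ∈ Finset.piAntidiag (Finset.univ : Finset (Fin k)) (m + 2),
      (Nat.multinomial Finset.univ t : ℝ) *
        ∏ i, (if _h : t i < m + 2 then omega p q (t i) else 0) =
      ∑ r ∈ Finset.Icc 2 (m + 2), (k.choose r : ℝ) * redPow (omega p q) r (m + 2) := by
    intro k
    have h2 := multiSum_eq_convPow a (m + 2) k
    have h3 : a 0 = 1 := by simp [ha, omega_zero]
    rw [convPow_eq_sum_redPow h3, sum_range_succ_eq_Icc (by omega)
      (by rw [redPow_zero_of_pos _ (by omega), mul_zero]), redPow_one _ (by omega)] at h2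
    have h4 : a (m + 2) = 0 := by simp [ha]
    rw [h4, mul_zero, zero_add] at h2
    simp only [dite_eq_ite]
    refine h2.trans (Finset.sum_congr rfl fun r hr => ?_)
    rw [redPow_congr_of_two_le (b := omega p q) (fun t ht => by simp [ha, ht])
      (Finset.mem_Icc.1 hr).1]
  simp only [h1, Finset.mul_sum]
  have hs : ∀ r ∈ Finset.Icc 2 (m + 2), Summable fun k =>
      (p k).toReal * ((k.choose r : ℝ) * redPow (omega p q) r (m + 2)) := fun r hr => by
    have := (summable_mul_choose hmom ((Finset.mem_Icc.1 hr).2.trans hj)).mul_right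
      (redPow (omega p q) r (m + 2))
    simpa only [mul_assoc] using this
  rw [Summable.tsum_finsetSum hs]
  refine Finset.sum_congr rfl fun r _ => ?_
  rw [mixedMoment_one_eq_tsum, ← tsum_mul_left]
  exact tsum_congr fun k => by ring

/-- The polynomial taking the value `∑ r ≤ n, z.choose r * c r` at `z`. -/
noncomputable def choosePolynomial (c : ℕ → ℝ) (n : ℕ) : Polynomial ℝ :=
  ∑ r ∈ Finset.range (n + 1), Polynomial.C (c r / r.factorial) * descPochhammer ℝ r

theorem choosePolynomial_eval (c : ℕ → ℝ) (n z : ℕ) : (choosePolynomial c n).eval (z : ℝ) =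
    ∑ r ∈ Finset.range (n + 1), c r * (z.choose r : ℝ) := by
  rw [choosePolynomial, Polynomial.eval_finsetSum]
  refine Finset.sum_congr rfl fun r _ => ?_
  rw [Polynomial.eval_mul, Polynomial.eval_C, descPochhammer_eval_eq_descFactorial,
    Nat.descFactorial_eq_factorial_mul_choose]
  have : (r.factorial : ℝ) ≠ 0 := by exact_mod_cast r.factorial_ne_zero
  push_cast
  field_simp

/-- Falling factorials of degree r < n cannot cancel the leading term of the one of degree n. -/
theorem choosePolynomial_natDegree {c : ℕ → ℝ} {n : ℕ} (h : c n ≠ 0) :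
    (choosePolynomial c n).natDegree = n := by
  have hc : c n / n.factorial ≠ 0 := div_ne_zero h (by exact_mod_cast n.factorial_ne_zero)
  have h1 : (Polynomial.C (c n / n.factorial) * descPochhammer ℝ n).degree = n := by
    rw [Polynomial.degree_C_mul hc, Polynomial.degree_eq_natDegree (monic_descPochhammer ℝ n).ne_zero,
      descPochhammer_natDegree]
  refine Polynomial.natDegree_eq_of_degree_eq_some ?_
  rw [choosePolynomial, Finset.sum_range_succ, Polynomial.degree_add_eq_right_of_degree_lt, h1]
  rw [h1]
  refine (Polynomial.degree_sum_le _ _).trans_lt ((Finset.sup_lt_iff (WithBot.bot_lt_coe n)).2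
    fun r hr => ?_)
  refine (Polynomial.degree_mul_le _ _).trans_lt
    ((add_le_add Polynomial.degree_C_le le_rfl).trans_lt ?_)
  rw [zero_add, Polynomial.degree_eq_natDegree (monic_descPochhammer ℝ r).ne_zero, descPochhammer_natDegree]
  exact WithBot.coe_lt_coe.2 (Finset.mem_range.1 hr)

end Supercritical

end MarkedGW

/-! ### The three regimes. -/

theorem theorem1 (p : PMF ℕ) (q : ℕ → unitInterval) (ℓ : ℕ) (hℓ : 1 ≤ ℓ)
    -- the offspring distribution is non-degenerate and has a finite moment of order `ℓ`
    (hp : (p 0).toReal + (p 1).toReal < 1)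
    (hmom : Summable fun k : ℕ => (k : ℝ) ^ ℓ * (p k).toReal)
    -- every individual is marked with positive probability
    (hq : ∃ k : ℕ, 0 < (p k).toReal * (q k : ℝ)) :
    -- the expectations are finite, and positive except that of `M_0 ^ ℓ`
    (∀ m : ℕ, Integrable (fun t => (M m t : ℝ) ^ ℓ) (law p q)) ∧
    (∀ m : ℕ, 1 ≤ m → 0 < ∫ t, (M m t : ℝ) ^ ℓ ∂(law p q)) ∧
    -- sub-critical case
    (mean p < 1 →
      (∀ᵐ t ∂(law p q), t.marked.Finite) ∧
      (∀ j ≤ ℓ, Integrable (fun t => (totalMarks t : ℝ) ^ j) (law p q)) ∧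
      (∀ j ≤ ℓ, Tendsto (fun r : ℕ => ∫ t, (M r t : ℝ) ^ j ∂(law p q)) atTop (𝓝 (xi p q j))) ∧
      0 < xi p q ℓ ∧
      IsPenalizationMartingale (law p q) ℓ (fun n t => f p q ℓ (M n t) (Z n t))) ∧
    -- critical case
    (mean p = 1 → IsPenalizationMartingale (law p q) ℓ (fun n t => (Z n t : ℝ))) ∧
    -- super-critical case
    (1 < mean p →
      (∀ j ≤ ℓ, Tendsto (fun r : ℕ => (∫ t, (M r t : ℝ) ^ j ∂(law p q)) / mean p ^ (j * r))
        atTop (𝓝 (omega p q j))) ∧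
      0 < omega p q ℓ ∧
      ∃ Q : Polynomial ℝ, Q.natDegree = ℓ ∧
        (∀ z : ℕ, Q.eval (z : ℝ) = multiSum (omega p q) ℓ z / omega p q ℓ) ∧
        IsPenalizationMartingale (law p q) ℓ
          (fun n t => Q.eval (Z n t : ℝ) / mean p ^ (ℓ * n))) := by
  have hx := momentRecursion q hp hmom hq
  have hμ : mixedMoment p q 1 0 1 = mean p := mixedMoment_one_one q
  refine ⟨fun m => integrable_M_pow q hmom m le_rfl,
    fun m hm => hx.pos_of_pos hm hℓ le_rfl, fun hlt => ?_, fun heq => ?_, fun hgt => ?_⟩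
  · have hfin : ∀ᵐ t ∂(law p q), t.marked.Finite :=
      (hx.exists_tendsto_of_lt_one (hμ ▸ hlt) hℓ).elim fun b hb => ae_marked_finite hmom hℓ hb
    have hlim : ∀ j ≤ ℓ, Tendsto (fun r => realMoment p q r j) atTop (𝓝 (xi p q j)) := by
      intro j hj
      obtain ⟨b, hb⟩ := hx.exists_tendsto_of_lt_one (hμ ▸ hlt) hj
      rwa [(integrable_totalMarks_pow hmom hfin hj hb).2]
    have hξ : 0 < xi p q ℓ := (hx.pos ℓ hℓ le_rfl).trans_le
      (ge_of_tendsto (hlim ℓ le_rfl) (eventually_atTop.2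
        ⟨1, fun m hm => hx.mono 1 m hm ℓ le_rfl⟩))
    refine ⟨hfin, fun j hj => (integrable_totalMarks_pow hmom hfin hj (hlim j hj)).1, hlim, hξ, ?_⟩
    simp only [f_eq_density (p := p) (q := q) (show xi p q 0 = 1 by simp [xi])]
    refine isPenalizationMartingale_density hℓ hp hmom hq fun n i r hi _ => ?_
    refine (tendsto_redPow (fun t ht => hlim t (ht.trans hi)) r).div ?_ hξ.ne'
    exact (hlim ℓ le_rfl).comp (tendsto_atTop_mono (fun m => Nat.le_add_left m n) tendsto_id)
  · have hB : (fun n t => (Z n t : ℝ)) = fun n t => density ℓ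
        (fun i r => if i = ℓ then (if r = 1 then 1 else 0) else 0) (M n t) (Z n t) := by
      funext n t
      rw [density_of_top (fun r => if r = 1 then 1 else 0)]
      simp only [ite_mul, one_mul, zero_mul, Finset.sum_ite_eq', Nat.choose_one_right]
      rw [if_pos (Finset.mem_range.2 (by omega))]
    rw [hB]
    refine isPenalizationMartingale_density hℓ hp hmom hq
      (L := fun _ i r => if i = ℓ then (if r = 1 then 1 else 0) else 0) fun n i r hi _ => ?_
    by_cases h : i = ℓ ∧ r = 1
    · obtain ⟨rfl, rfl⟩ := h
      simp only [if_true, redPow_one _ hℓ]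
      exact hx.tendsto_div_add_of_eq_one (hμ.trans heq) hℓ n
    · have h0 : (if i = ℓ then (if r = 1 then (1 : ℝ) else 0) else 0) = 0 := by
        split_ifs with h1 h2
        exacts [absurd ⟨h1, h2⟩ h, rfl, rfl]
      rw [h0]
      exact hx.tendsto_redPow_div_of_eq_one (hμ.trans heq) hℓ n hi h
  · have hω := fun j hj2 hj => omega_of_two_le (p := p) (q := q) (ℓ := ℓ) hmom (j := j) hj2 hj
    have hgt' : 1 < mixedMoment p q 1 0 1 := hμ ▸ hgt
    have hlim : ∀ j ≤ ℓ, Tendsto (fun r => realMoment p q r j / mean p ^ (j * r)) atTop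
        (𝓝 (omega p q j)) := fun j hj => by
      have := hx.tendsto_div_pow hgt' omega_zero omega_one hω hj
      rwa [hμ] at this
    have hpos : ∀ j, 1 ≤ j → j ≤ ℓ → 0 < omega p q j := fun j h1 hj =>
      hx.limit_pos hgt' omega_one hω h1 hj
    have hωℓ := hpos ℓ hℓ le_rfl
    refine ⟨hlim, hωℓ, choosePolynomial (fun r => redPow (omega p q) r ℓ / omega p q ℓ) ℓ,
      choosePolynomial_natDegree (div_pos ?_ hωℓ).ne', fun z => ?_, ?_⟩
    -- `redPow_pos` asks for nonnegativity at every index, while the sign of ω is known only up to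
    -- ℓ; hence the cutoff.
    · rw [redPow_congr (b := fun t => if t ≤ ℓ then omega p q t else 0) fun t ht => by rw [if_pos ht]]
      refine redPow_pos (fun t => ?_) (fun t h1 h2 => by simp only [h2, if_true, hpos t h1 h2])
        hℓ le_rfl
      split_ifs with ht
      · rcases Nat.eq_zero_or_pos t with rfl | h0
        · rw [omega_zero]; exact zero_le_one
        · exact (hpos t h0 ht).le
      · exact le_rfl
    · rw [choosePolynomial_eval, multiSum_eq_convPow, convPow_eq_sum_redPow omega_zero,
        Finset.sum_div]
      exact Finset.sum_congr rfl fun r _ => by ring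
    · have hB : (fun n t => (choosePolynomial (fun r => redPow (omega p q) r ℓ / omega p q ℓ) ℓ).eval
          (Z n t : ℝ) / mean p ^ (ℓ * n)) = fun n t => density ℓ (fun i r => if i = ℓ then
            redPow (omega p q) r ℓ / omega p q ℓ / mean p ^ (ℓ * n) else 0) (M n t) (Z n t) := by
        funext n t
        rw [density_of_top, choosePolynomial_eval, Finset.sum_div]
        exact Finset.sum_congr rfl fun r _ => by ring
      rw [hB]
      refine isPenalizationMartingale_density hℓ hp hmom hq (L := fun n i r => if i = ℓ then
        redPow (omega p q) r ℓ / omega p q ℓ / mean p ^ (ℓ * n) else 0) fun n i r hi _ => ?_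
      have h0 : 0 < mean p := by linarith
      -- Numerator and denominator are both normalized by μ^(ℓm); the time shift n in the
      -- denominator produces the factor μ^(ℓn) dividing P_ℓ(Z_n).
      have hden : Tendsto (fun m => realMoment p q (n + m) ℓ / mean p ^ (ℓ * m)) atTop
          (𝓝 (omega p q ℓ * mean p ^ (ℓ * n))) := by
        have := ((hlim ℓ le_rfl).comp (tendsto_atTop_mono (fun m => Nat.le_add_left m n)
          tendsto_id)).mul_const (mean p ^ (ℓ * n))
        refine this.congr fun m => ?_
        simp only [Function.comp_apply]
        rw [mul_add, pow_add]
        field_simp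
      have hne : omega p q ℓ * mean p ^ (ℓ * n) ≠ 0 := by positivity
      have hnum : Tendsto (fun m => redPow (realMoment p q m) r i / mean p ^ (ℓ * m)) atTop
          (𝓝 (if i = ℓ then redPow (omega p q) r ℓ else 0)) := by
        split_ifs with h
        · subst h
          exact (tendsto_redPow hlim r).congr fun m => redPow_div_pow _ _ _ _ _
        · exact tendsto_redPow_div_pow hgt (lt_of_le_of_ne hi h)
            (fun t ht => hlim t (ht.trans hi)) r
      have h1 := hnum.div hden hne
      have h2 : (if i = ℓ then redPow (omega p q) r ℓ else 0) / (omega p q ℓ * mean p ^ (ℓ * n)) =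
          if i = ℓ then redPow (omega p q) r ℓ / omega p q ℓ / mean p ^ (ℓ * n) else 0 := by
        split_ifs
        · rw [div_div]
        · rw [zero_div]
      rw [h2] at h1
      refine h1.congr fun m => ?_
      rw [Pi.div_apply, div_div_div_cancel_right₀ (by positivity)]
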